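/- Let $\mathbb K\in\{\mathbb R,\mathbb C\}$, let $M$ be a connected (non-empty), Hausdorff, paracompact, finite-dimensional real smooth manifold, let $\mathfrak k$ be a finite-dimensional Lie algebra over $\mathbb K$, and let $\pi:\mathbb L\to M$ be a smooth bundle of Lie algebras with fiber $\mathfrak k$, i.e. a smooth vector bundle whose transition maps take values in the group $\operatorname{Aut}(\mathfrak k)$ of Lie algebra automorphisms, so that every fiber $\mathbb L_x$ is a Lie algebra and the bundle charts are fiberwise Lie algebra isomorphisms onto $\mathfrak k$. For $k\in\{0,1,2,\dots\}\cup\{\infty\}$ let $\Gamma^k(\mathbb L)$ be the Lie algebra of $C^k$-sections of $\mathbb L$ with the pointwise bracket. A Lie algebra is called indecomposable if it is not the direct sum of two proper ideals. Suppose that $\mathfrak k$ is perfect ($\mathfrak k=[\mathfrak k,\mathfrak k]$) or centerfree (its center is $0$), and let $\mathfrak k=\bigoplus_{i=1}^n\mathfrak k_i$ be a decomposition into a direct sum of indecomposable non-zero ideals. Put $H(\mathfrak k)=\bigcap_{i=1}^n\{f\in\operatorname{Aut}(\mathfrak k)\mid f(\mathfrak k_i)=\mathfrak k_i\}$, which is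 a normal subgroup of $\operatorname{Aut}(\mathfrak k)$, and let $G(\mathfrak k)=\operatorname{Aut}(\mathfrak k)/H(\mathfrak k)$, regarded as a discrete group. Let $\check H^1(M,G(\mathfrak k))$ be the first Čech cohomology set, i.e. the direct limit over the open covers $\mathfrak V$ of $M$ of the sets of families of locally constant functions $g_{VU}:U\cap V\to G(\mathfrak k)$ $(U,V\in\mathfrak V)$ with $g_{VU}\,g_{UW}=g_{VW}$ on $U\cap V\cap W$, modulo the relation $g_{VU}\sim h_V\,g_{VU}\,h_U^{-1}$ for families of locally constant functions $h_U:U\to G(\mathfrak k)$. If $\check H^1(M,G(\mathfrak k))$ is trivial (which is the case, for example, if $M$ is simply connected), then there are subbundles $\mathbb L^1,\dots,\mathbb L^n$ of $\mathbb L$, where $\mathbb L^i$ has fiber $\mathfrak k_i$ (around every point of $M$ there is a bundle chart of $\mathbb L$ that maps $\mathbb L^i_x$ onto $\mathfrak k_i$ for all $x$ in its domain), such that $$\Gamma^k(\mathbb L)=\bigoplus_{i=1}^n\Gamma^k(\mathbb L^i)$$ is a decomposition into a direct sum of indecomposable non-zero ideals. This decomposition is unique up to order: any decomposition of $\Gamma^k(\mathbb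 L)$ into a direct sum of indecomposable non-zero ideals has exactly the summands $\Gamma^k(\mathbb L^1),\dots,\Gamma^k(\mathbb L^n)$, each once. -/

import Mathlib

open Bundle TopologicalSpace
open scoped Manifold ContDiff

namespace LieSec

/-! ### Lie algebras: perfect, centerfree, indecomposable -/

section Algebra

variable (𝕜 : Type*) (𝔤 : Type*) [CommRing 𝕜] [LieRing 𝔤] [LieAlgebra 𝕜 𝔤]

/-- `𝔤 = [𝔤, 𝔤]`. -/
def IsPerfect : Prop := ⁅(⊤ : LieIdeal 𝕜 𝔤), (⊤ : LieIdeal 𝕜 𝔤)⁆ = ⊤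

/-- The center of `𝔤` is zero. -/
def IsCenterfree : Prop := LieAlgebra.center 𝕜 𝔤 = ⊥

/-- `𝔤` is not the direct sum of two proper ideals. -/
def IsIndecomposable : Prop :=
  ¬ ∃ I J : LieIdeal 𝕜 𝔤, I ≠ ⊤ ∧ J ≠ ⊤ ∧ IsCompl I J

variable {𝔤}

/-- `𝔤 = ⨁ i, I i` is a decomposition into a direct sum of indecomposable non-zero ideals. -/
structure IsIndecDecomp {ι : Type*} (I : ι → LieIdeal 𝕜 𝔤) : Prop where
  independent : iSupIndep I
  iSup_eq_top : ⨆ i, I i = ⊤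
  ne_bot : ∀ i, I i ≠ ⊥
  indecomposable : ∀ i, IsIndecomposable 𝕜 (I i)

variable {𝕜}

theorem IsIndecDecomp.isCompl {ι : Type*} {I : ι → LieIdeal 𝕜 𝔤} (h : IsIndecDecomp 𝕜 I) (i : ι) :
    IsCompl (I i) (⨆ (j) (_ : j ≠ i), I j) := by
  refine ⟨h.independent i, codisjoint_iff.mpr (top_le_iff.mp ?_)⟩
  rw [← h.iSup_eq_top]
  refine iSup_le fun j => ?_
  by_cases hj : j = i
  · subst hj; exact le_sup_left
  · exact le_sup_of_le_right (le_iSup₂_of_le j hj le_rfl)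

theorem le_inf_sup_inf (hk : IsPerfect 𝕜 𝔤 ∨ IsCenterfree 𝕜 𝔤) {A A' B B' : LieIdeal 𝕜 𝔤}
    (hA : IsCompl A A') (hB : IsCompl B B') : B ≤ (B ⊓ A) ⊔ (B ⊓ A') := by
  rcases hk with hp | hc
  · have h0 : ⁅B, B'⁆ = ⊥ := le_bot_iff.mp (hB.inf_eq_bot ▸ LieSubmodule.lie_le_inf B B')
    have h0' : ⁅B', B⁆ = ⊥ := by rw [LieSubmodule.lie_comm, h0]
    have h1 : ⁅B, B⁆ ⊔ ⁅B', B'⁆ = ⊤ := by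
      have := hp
      rw [IsPerfect, ← hB.sup_eq_top, LieSubmodule.sup_lie, LieSubmodule.lie_sup,
        LieSubmodule.lie_sup, h0, h0'] at this
      simpa [hB.sup_eq_top] using this
    have h2 : B ≤ ⁅B, B⁆ := by
      intro x hx
      have hx' : x ∈ ⁅B, B⁆ ⊔ ⁅B', B'⁆ := h1 ▸ LieSubmodule.mem_top x
      obtain ⟨y, hy, z, hz, rfl⟩ := LieSubmodule.mem_sup _ _ _ |>.mp hx'
      have hyB : y ∈ B := LieSubmodule.lie_le_left B B hy
      have hzB : z ∈ B := by simpa using sub_mem hx hyB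
      have hz0 : z ∈ B ⊓ B' := ⟨hzB, LieSubmodule.lie_le_left B' B' hz⟩
      rw [hB.inf_eq_bot, LieSubmodule.mem_bot] at hz0
      simpa [hz0] using hy
    calc B ≤ ⁅B, B⁆ := h2
      _ ≤ ⁅B, A ⊔ A'⁆ := LieSubmodule.mono_lie_right _ (by rw [hA.sup_eq_top]; exact le_top)
      _ = ⁅B, A⁆ ⊔ ⁅B, A'⁆ := LieSubmodule.lie_sup ..
      _ ≤ _ := sup_le_sup (LieSubmodule.lie_le_inf B A) (LieSubmodule.lie_le_inf B A')
  · have key : ∀ {C D : LieIdeal 𝕜 𝔤}, IsCompl C D → ∀ {c d : 𝔤}, c ∈ C → d ∈ D → ⁅c, d⁆ = 0 := by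
      intro C D h c d hc hd
      have : ⁅c, d⁆ ∈ C ⊓ D := ⟨lie_mem_left 𝕜 𝔤 C c d hc, lie_mem_right 𝕜 𝔤 D c d hd⟩
      rwa [h.inf_eq_bot, LieSubmodule.mem_bot] at this
    intro x hx
    obtain ⟨a, ha, a', ha', rfl⟩ := (LieSubmodule.mem_sup _ _ _).mp
      (hA.sup_eq_top ▸ LieSubmodule.mem_top x : x ∈ A ⊔ A')
    obtain ⟨b, hb, b', hb', hab⟩ := (LieSubmodule.mem_sup _ _ _).mp
      (hB.sup_eq_top ▸ LieSubmodule.mem_top a : a ∈ B ⊔ B')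
    have hz : b' ∈ LieAlgebra.center 𝕜 𝔤 := by
      rw [LieModule.mem_maxTrivSubmodule]
      intro y
      obtain ⟨y₁, h₁, y₂, h₂, rfl⟩ := (LieSubmodule.mem_sup _ _ _).mp
        (hB.sup_eq_top ▸ LieSubmodule.mem_top y : y ∈ B ⊔ B')
      have e1 : ⁅y₁, b'⁆ = 0 := key hB h₁ hb'
      have e2 : ⁅y₂, b'⁆ = ⁅y₂, a⁆ := by
        rw [← hab, lie_add, key hB.symm h₂ hb, zero_add]
      have e3 : ⁅y₂, a⁆ = -⁅y₂, a'⁆ := by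
        have := key hB.symm h₂ hx
        rw [lie_add] at this
        exact eq_neg_of_add_eq_zero_left this
      have e4 : ⁅y₂, a⁆ ∈ A ⊓ A' :=
        ⟨lie_mem_right 𝕜 𝔤 A _ _ ha, e3 ▸ neg_mem (lie_mem_right 𝕜 𝔤 A' _ _ ha')⟩
      rw [hA.inf_eq_bot, LieSubmodule.mem_bot] at e4
      rw [add_lie, e1, e2, e4, add_zero]
    rw [show LieAlgebra.center 𝕜 𝔤 = ⊥ from hc, LieSubmodule.mem_bot] at hz
    have haB : a ∈ B := by rw [← hab, hz, add_zero]; exact hb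
    have haB' : a' ∈ B := by simpa using sub_mem hx haB
    exact (LieSubmodule.mem_sup _ _ _).mpr ⟨a, ⟨haB, ha⟩, a', ⟨haB', ha'⟩, rfl⟩

theorem le_or_le_of_isCompl (hk : IsPerfect 𝕜 𝔤 ∨ IsCenterfree 𝕜 𝔤) {A A' B B' : LieIdeal 𝕜 𝔤}
    (hA : IsCompl A A') (hB : IsCompl B B') (hi : IsIndecomposable 𝕜 B) : B ≤ A ∨ B ≤ A' := by
  by_contra! hcon
  refine hi ⟨LieIdeal.comap B.incl A, LieIdeal.comap B.incl A', fun h => hcon.1 fun x hx => ?_,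
    fun h => hcon.2 fun x hx => ?_, disjoint_iff.mpr ?_, codisjoint_iff.mpr ?_⟩
  · have : (⟨x, hx⟩ : B) ∈ LieIdeal.comap B.incl A := h ▸ LieSubmodule.mem_top _
    exact LieIdeal.mem_comap.mp this
  · have : (⟨x, hx⟩ : B) ∈ LieIdeal.comap B.incl A' := h ▸ LieSubmodule.mem_top _
    exact LieIdeal.mem_comap.mp this
  · rw [LieSubmodule.eq_bot_iff]
    rintro ⟨x, hx⟩ ⟨h1, h2⟩
    have : x ∈ A ⊓ A' := ⟨LieIdeal.mem_comap.mp h1, LieIdeal.mem_comap.mp h2⟩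
    rw [hA.inf_eq_bot, LieSubmodule.mem_bot] at this
    exact Subtype.ext this
  · rw [eq_top_iff]
    rintro ⟨x, hx⟩ -
    obtain ⟨a, ha, a', ha', haa⟩ := (LieSubmodule.mem_sup _ _ _).mp (le_inf_sup_inf hk hA hB hx)
    exact (LieSubmodule.mem_sup _ _ _).mpr ⟨⟨a, ha.1⟩, LieIdeal.mem_comap.mpr ha.2,
      ⟨a', ha'.1⟩, LieIdeal.mem_comap.mpr ha'.2, Subtype.ext haa⟩

theorem IsIndecDecomp.exists_eq (hk : IsPerfect 𝕜 𝔤 ∨ IsCenterfree 𝕜 𝔤) {ι κ : Type*}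
    {I : ι → LieIdeal 𝕜 𝔤} {J : κ → LieIdeal 𝕜 𝔤} (hI : IsIndecDecomp 𝕜 I)
    (hJ : IsIndecDecomp 𝕜 J) (j : κ) : ∃ i, J j = I i := by
  have h1 : ∃ i, I i ≤ J j := by
    by_contra! h
    have : ∀ i, I i ≤ ⨆ (l) (_ : l ≠ j), J l := fun i =>
      (le_or_le_of_isCompl hk (hJ.isCompl j) (hI.isCompl i) (hI.indecomposable i)).resolve_left
        (h i)
    have h2 := iSup_le this
    rw [hI.iSup_eq_top, top_le_iff] at h2
    have h3 := (hJ.isCompl j).inf_eq_bot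
    rw [h2, inf_top_eq] at h3
    exact hJ.ne_bot j h3
  obtain ⟨i, hi⟩ := h1
  refine ⟨i, le_antisymm ?_ hi⟩
  refine (le_or_le_of_isCompl hk (hI.isCompl i) (hJ.isCompl j) (hJ.indecomposable j)).resolve_right
    fun h => hI.ne_bot i ?_
  have h3 := (hI.isCompl i).inf_eq_bot
  rwa [inf_eq_left.mpr (hi.trans h)] at h3

/-! ### Automorphisms and the groups `H(𝔤)` and `G(𝔤)` -/

/-- Pulling back ideals along a Lie algebra isomorphism. -/
def comapOrderIso {𝔥 : Type*} [LieRing 𝔥] [LieAlgebra 𝕜 𝔥] (e : 𝔤 ≃ₗ⁅𝕜⁆ 𝔥) :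
    LieIdeal 𝕜 𝔥 ≃o LieIdeal 𝕜 𝔤 where
  toFun J := LieIdeal.comap e.toLieHom J
  invFun I := LieIdeal.comap e.symm.toLieHom I
  left_inv J := by ext x; simp [LieIdeal.mem_comap]
  right_inv I := by ext x; simp [LieIdeal.mem_comap]
  map_rel_iff' := by
    intro J J'
    refine ⟨fun h x hx => ?_, fun h x hx => ?_⟩
    · have : e.symm x ∈ LieIdeal.comap e.toLieHom J := by simpa [LieIdeal.mem_comap] using hx
      simpa [LieIdeal.mem_comap] using h this
    · exact LieIdeal.mem_comap.mpr (h (LieIdeal.mem_comap.mp hx))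

theorem IsIndecomposable.of_equiv {𝔥 : Type*} [LieRing 𝔥] [LieAlgebra 𝕜 𝔥] (e : 𝔤 ≃ₗ⁅𝕜⁆ 𝔥)
    (h : IsIndecomposable 𝕜 𝔤) : IsIndecomposable 𝕜 𝔥 := by
  rintro ⟨I, J, hI, hJ, hIJ⟩
  exact h ⟨comapOrderIso e I, comapOrderIso e J, by simpa using hI, by simpa using hJ,
    (comapOrderIso e).isCompl hIJ⟩

/-- The isomorphism from an ideal onto its preimage under an automorphism. -/
def comapEquiv (e : 𝔤 ≃ₗ⁅𝕜⁆ 𝔤) (I : LieIdeal 𝕜 𝔤) : I ≃ₗ⁅𝕜⁆ comapOrderIso e I where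
  toFun x := ⟨e.symm x, LieIdeal.mem_comap.mpr (by simp)⟩
  invFun x := ⟨e x, LieIdeal.mem_comap.mp x.2⟩
  map_add' x y := Subtype.ext (by simp)
  map_smul' c x := Subtype.ext (by simp)
  map_lie' {x y} := Subtype.ext (e.symm.map_lie x.1 y.1)
  left_inv x := Subtype.ext (by simp)
  right_inv x := Subtype.ext (by simp)

theorem IsIndecDecomp.comap {ι : Type*} {I : ι → LieIdeal 𝕜 𝔤} (hI : IsIndecDecomp 𝕜 I)
    (e : 𝔤 ≃ₗ⁅𝕜⁆ 𝔤) : IsIndecDecomp 𝕜 (fun i => comapOrderIso e (I i)) where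
  independent := hI.independent.map_orderIso (comapOrderIso e)
  iSup_eq_top := by rw [← OrderIso.map_iSup, hI.iSup_eq_top, OrderIso.map_top]
  ne_bot i := by simpa using hI.ne_bot i
  indecomposable i := (hI.indecomposable i).of_equiv (comapEquiv e (I i))

variable (𝕜 𝔤) in
/-- The group `Aut(𝔤)` of Lie algebra automorphisms. -/
def autGroup : Subgroup (𝔤 ≃ₗ[𝕜] 𝔤) where
  carrier := {f | ∀ x y, f ⁅x, y⁆ = ⁅f x, f y⁆}
  one_mem' _ _ := rfl
  mul_mem' {f g} hf hg x y := by
    rw [LinearEquiv.mul_apply, hg, hf]; rfl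
  inv_mem' {f} hf x y := by
    change f.symm ⁅x, y⁆ = ⁅f.symm x, f.symm y⁆
    rw [LinearEquiv.symm_apply_eq, hf, f.apply_symm_apply, f.apply_symm_apply]

/-- An element of `Aut(𝔤)` as a Lie algebra equivalence. -/
def autGroup.toLieEquiv (f : autGroup 𝕜 𝔤) : 𝔤 ≃ₗ⁅𝕜⁆ 𝔤 :=
  { f.1 with map_lie' := f.2 _ _ }

/-- The subgroup `H(𝔤) = ⋂ i, {f ∈ Aut(𝔤) | f (I i) = I i}` of `Aut(𝔤)`. -/
def stabGroup {ι : Type*} (I : ι → LieIdeal 𝕜 𝔤) : Subgroup (autGroup 𝕜 𝔤) where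
  carrier := {f | ∀ i, f.1 '' (I i : Set 𝔤) = I i}
  one_mem' i := by simp
  mul_mem' {f g} hf hg i := by
    have : ((f * g : autGroup 𝕜 𝔤).1 : 𝔤 → 𝔤) = f.1 ∘ g.1 := rfl
    rw [this, Set.image_comp, hg i, hf i]
  inv_mem' {f} hf i := by
    have h : ((f⁻¹ : autGroup 𝕜 𝔤).1 : 𝔤 → 𝔤) = f.1.symm := rfl
    rw [h]
    nth_rewrite 1 [← hf i]
    rw [← Set.image_comp]
    simp

theorem stabGroup_normal (hk : IsPerfect 𝕜 𝔤 ∨ IsCenterfree 𝕜 𝔤) {ι : Type*}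
    {I : ι → LieIdeal 𝕜 𝔤} (hI : IsIndecDecomp 𝕜 I) : (stabGroup I).Normal where
  conj_mem f hf g i := by
    obtain ⟨l, hl⟩ := hI.exists_eq hk (hI.comap (autGroup.toLieEquiv g)) i
    have h1 : (I l : Set 𝔤) = g.1 ⁻¹' (I i : Set 𝔤) := by
      rw [← hl]; rfl
    have h2 : ((g * f * g⁻¹ : autGroup 𝕜 𝔤).1 : 𝔤 → 𝔤) = g.1 ∘ f.1 ∘ g.1.symm := rfl
    have h3 : g.1.symm '' (I i : Set 𝔤) = I l := by
      rw [h1]; exact g.1.toEquiv.symm.image_eq_preimage_symm _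
    rw [h2, Set.image_comp, Set.image_comp, h3, hf l, h1]
    exact Set.image_preimage_eq _ g.1.surjective

/-- The quotient group `G(𝔤) = Aut(𝔤) / H(𝔤)`, for a decomposition of a perfect or centerfree Lie
algebra into indecomposable non-zero ideals. -/
@[nolint unusedArguments]
def QuotGroup {ι : Type*} (I : ι → LieIdeal 𝕜 𝔤) (_hk : IsPerfect 𝕜 𝔤 ∨ IsCenterfree 𝕜 𝔤)
    (_hI : IsIndecDecomp 𝕜 I) : Type _ :=
  autGroup 𝕜 𝔤 ⧸ stabGroup I

instance {ι : Type*} (I : ι → LieIdeal 𝕜 𝔤) (hk : IsPerfect 𝕜 𝔤 ∨ IsCenterfree 𝕜 𝔤)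
    (hI : IsIndecDecomp 𝕜 I) : Group (QuotGroup I hk hI) :=
  haveI := stabGroup_normal hk hI
  inferInstanceAs (Group (autGroup 𝕜 𝔤 ⧸ stabGroup I))

end Algebra

/-! ### First Čech cohomology with values in a discrete group -/

section Cech

variable (M : Type*) [TopologicalSpace M] (G : Type*) [Group G]

/-- A set of open subsets of `M` that covers `M`. -/
structure OpenCov where
  sets : Set (Opens M)
  covers : ∀ x : M, ∃ U ∈ sets, x ∈ U

variable {M}

/-- Čech 1-cocycles on a cover, `g V U * g U W = g V W` on `U ∩ V ∩ W` (hence `g U U = 1` and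
`g V U * g U W * g W V = 1`). The smooth functions to the discrete group `G` are the locally
constant ones. -/
@[ext]
structure Cocycle (𝔙 : OpenCov M) where
  val : ∀ V U : 𝔙.sets, LocallyConstant ↥(U.1 ⊓ V.1) G
  cocycle : ∀ (U V W : 𝔙.sets) (x : M) (hU : x ∈ U.1) (hV : x ∈ V.1) (hW : x ∈ W.1),
    val V U ⟨x, hU, hV⟩ * val U W ⟨x, hW, hU⟩ = val V W ⟨x, hW, hV⟩

variable {G}

/-- `g` and `k` are cohomologous: `k V U = h V * g V U * (h U)⁻¹` on `U ∩ V`. -/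
def Cocycle.Cohomologous {𝔙 : OpenCov M} (g k : Cocycle G 𝔙) : Prop :=
  ∃ h : ∀ U : 𝔙.sets, LocallyConstant ↥U.1 G, ∀ (U V : 𝔙.sets) (x : M) (hU : x ∈ U.1)
    (hV : x ∈ V.1), k.val V U ⟨x, hU, hV⟩ = h V ⟨x, hV⟩ * g.val V U ⟨x, hU, hV⟩ * (h U ⟨x, hU⟩)⁻¹

/-- A refinement map: `𝔚` refines `𝔙`, with a choice of a member of `𝔙` containing each member
of `𝔚`. -/
structure Refinement (𝔚 𝔙 : OpenCov M) where
  map : 𝔚.sets → 𝔙.sets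
  le : ∀ W, W.1 ≤ (map W).1

/-- The inclusion of `U` into `U'`. -/
def inclMap {U U' : Opens M} (h : U ≤ U') : C(↥U, ↥U') :=
  ⟨fun x => ⟨x.1, h x.2⟩, by fun_prop⟩

/-- The pullback of a cocycle to a refinement. -/
def Cocycle.pullback {𝔙 𝔚 : OpenCov M} (g : Cocycle G 𝔙) (f : Refinement 𝔚 𝔙) : Cocycle G 𝔚 where
  val V U := (g.val (f.map V) (f.map U)).comap (inclMap (inf_le_inf (f.le U) (f.le V)))
  cocycle U V W x hU hV hW :=
    g.cocycle (f.map U) (f.map V) (f.map W) x (f.le U hU) (f.le V hV) (f.le W hW)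

/-- Composition of refinement maps. -/
def Refinement.comp {𝔘 𝔙 𝔚 : OpenCov M} (f : Refinement 𝔚 𝔙) (e : Refinement 𝔘 𝔚) :
    Refinement 𝔘 𝔙 := ⟨f.map ∘ e.map, fun U => (e.le U).trans (f.le _)⟩

theorem Cocycle.Cohomologous.refl {𝔙 : OpenCov M} (g : Cocycle G 𝔙) : g.Cohomologous g :=
  ⟨fun _ => LocallyConstant.const _ 1, fun U V x hU hV => by simp⟩

theorem Cocycle.Cohomologous.symm {𝔙 : OpenCov M} {g k : Cocycle G 𝔙} (h : g.Cohomologous k) :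
    k.Cohomologous g := by
  obtain ⟨h, hh⟩ := h
  refine ⟨fun U => (h U)⁻¹, fun U V x hU hV => ?_⟩
  rw [hh U V x hU hV]
  simp [mul_assoc]

theorem Cocycle.Cohomologous.trans {𝔙 : OpenCov M} {g k l : Cocycle G 𝔙} (h : g.Cohomologous k)
    (h' : k.Cohomologous l) : g.Cohomologous l := by
  obtain ⟨h, hh⟩ := h
  obtain ⟨h', hh'⟩ := h'
  refine ⟨fun U => h' U * h U, fun U V x hU hV => ?_⟩
  rw [hh' U V x hU hV, hh U V x hU hV]
  simp [mul_assoc]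

theorem Cocycle.Cohomologous.pullback {𝔙 𝔚 : OpenCov M} {g k : Cocycle G 𝔙} (h : g.Cohomologous k)
    (f : Refinement 𝔚 𝔙) : (g.pullback f).Cohomologous (k.pullback f) := by
  obtain ⟨h, hh⟩ := h
  exact ⟨fun U => (h (f.map U)).comap (inclMap (f.le U)),
    fun U V x hU hV => hh _ _ x (f.le U hU) (f.le V hV)⟩

/-- The class of a pullback does not depend on the refinement map. -/
theorem Cocycle.pullback_cohomologous {𝔙 𝔚 : OpenCov M} (g : Cocycle G 𝔙)
    (f f' : Refinement 𝔚 𝔙) : (g.pullback f).Cohomologous (g.pullback f') := by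
  refine ⟨fun U => (g.val (f'.map U) (f.map U)).comap (inclMap (le_inf (f.le U) (f'.le U))), fun U V x hU hV => ?_⟩
  change g.val _ _ ⟨x, _⟩ = g.val _ _ ⟨x, _⟩ * g.val _ _ ⟨x, _⟩ * (g.val _ _ ⟨x, _⟩)⁻¹
  rw [eq_mul_inv_iff_mul_eq,
    g.cocycle _ _ _ x (f'.le U hU) (f'.le V hV) (f.le U hU),
    g.cocycle _ _ _ x (f.le V hV) (f'.le V hV) (f.le U hU)]

theorem Cocycle.pullback_comp {𝔘 𝔙 𝔚 : OpenCov M} (g : Cocycle G 𝔙) (f : Refinement 𝔚 𝔙)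
    (e : Refinement 𝔘 𝔚) : g.pullback (f.comp e) = (g.pullback f).pullback e := rfl

/-- Any two covers have a common refinement. -/
theorem OpenCov.exists_common (𝔙 𝔚 : OpenCov M) :
    ∃ 𝔘 : OpenCov M, Nonempty (Refinement 𝔘 𝔙) ∧ Nonempty (Refinement 𝔘 𝔚) := by
  refine ⟨⟨{U | ∃ V ∈ 𝔙.sets, ∃ W ∈ 𝔚.sets, U = V ⊓ W}, fun x => ?_⟩, ?_, ?_⟩
  · obtain ⟨V, hV, hx⟩ := 𝔙.covers x
    obtain ⟨W, hW, hx'⟩ := 𝔚.covers x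
    exact ⟨V ⊓ W, ⟨V, hV, W, hW, rfl⟩, hx, hx'⟩
  · have : ∀ U : {U | ∃ V ∈ 𝔙.sets, ∃ W ∈ 𝔚.sets, U = V ⊓ W}, ∃ V : 𝔙.sets, U.1 ≤ V.1 := by
      rintro ⟨_, V, hV, W, hW, rfl⟩
      exact ⟨⟨V, hV⟩, inf_le_left⟩
    choose f hf using this
    exact ⟨⟨f, hf⟩⟩
  · have : ∀ U : {U | ∃ V ∈ 𝔙.sets, ∃ W ∈ 𝔚.sets, U = V ⊓ W}, ∃ W : 𝔚.sets, U.1 ≤ W.1 := by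
      rintro ⟨_, V, hV, W, hW, rfl⟩
      exact ⟨⟨W, hW⟩, inf_le_right⟩
    choose f hf using this
    exact ⟨⟨f, hf⟩⟩

variable (M G)

/-- The relation defining the direct limit over all covers: two cocycles are identified when they
become cohomologous on a common refinement. -/
def cechSetoid : Setoid (Σ 𝔙 : OpenCov M, Cocycle G 𝔙) where
  r g k := ∃ (𝔘 : OpenCov M) (f : Refinement 𝔘 g.1) (f' : Refinement 𝔘 k.1),
    (g.2.pullback f).Cohomologous (k.2.pullback f')
  iseqv := by
    refine ⟨fun g => ⟨g.1, ⟨id, fun _ => le_rfl⟩, ⟨id, fun _ => le_rfl⟩, .refl _⟩, ?_, ?_⟩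
    · rintro g k ⟨𝔘, f, f', h⟩
      exact ⟨𝔘, f', f, h.symm⟩
    · rintro g k l ⟨𝔘, f, f', h⟩ ⟨𝔘', e, e', h'⟩
      obtain ⟨𝔘₂, ⟨p⟩, ⟨q⟩⟩ := 𝔘.exists_common 𝔘'
      refine ⟨𝔘₂, f.comp p, e'.comp q, ?_⟩
      have h1 := h.pullback p
      have h2 := h'.pullback q
      simp only [← Cocycle.pullback_comp] at h1 h2
      exact h1.trans ((k.2.pullback_cohomologous _ _).trans h2)

/-- The first Čech cohomology set `Ȟ¹(M, G) = lim Ȟ¹(M, 𝔙, G)` of `M` with values in the discrete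
group `G`. It always contains the class of the trivial cocycle, so it is trivial if and only if it
is a subsingleton. -/
def CechH1 : Type _ := Quotient (cechSetoid M G)

end Cech

/-! ### Bundles of Lie algebras and their sections -/

section Bundles

/-- A Lie ring with a norm of its additive group. No compatibility of norm and bracket is assumed:
for finite-dimensional Lie algebras, the norm merely gives the vector space topology. -/
class NormedLieRing (𝔨 : Type*) extends NormedAddCommGroup 𝔨, LieRing 𝔨

/-- A Lie algebra which is also a normed space (with the same vector space structure). -/
class NormedLieAlgebra (𝕜 𝔨 : Type*) [NormedField 𝕜] [NormedLieRing 𝔨] extends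
  NormedSpace 𝕜 𝔨, LieAlgebra 𝕜 𝔨

/-- Pointwise Lie bracket on a product. -/
instance piLieRing {ι : Type*} (L : ι → Type*) [∀ i, LieRing (L i)] : LieRing (∀ i, L i) where
  bracket X Y := fun i => ⁅X i, Y i⁆
  add_lie X Y Z := funext fun i => add_lie (X i) (Y i) (Z i)
  lie_add X Y Z := funext fun i => lie_add (X i) (Y i) (Z i)
  lie_self X := funext fun i => lie_self (X i)
  leibniz_lie X Y Z := funext fun i => leibniz_lie (X i) (Y i) (Z i)

instance piLieAlgebra (𝕜 : Type*) [CommRing 𝕜] {ι : Type*} (L : ι → Type*) [∀ i, LieRing (L i)]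
    [∀ i, LieAlgebra 𝕜 (L i)] : LieAlgebra 𝕜 (∀ i, L i) where
  lie_smul c X Y := funext fun i => lie_smul c (X i) (Y i)

variable (𝕜 : Type*) [RCLike 𝕜]
  {V : Type*} [NormedAddCommGroup V] [NormedSpace ℝ V]
  {M : Type*} [TopologicalSpace M] [ChartedSpace V M]
  (𝔨 : Type*) [NormedLieRing 𝔨] [NormedLieAlgebra 𝕜 𝔨] [NormedSpace ℝ 𝔨]
  (L : M → Type*) [∀ x, LieRing (L x)] [∀ x, LieAlgebra 𝕜 (L x)]
  [TopologicalSpace (TotalSpace 𝔨 L)]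

variable {𝔨 L} in
/-- A local trivialization that is fibrewise an isomorphism of Lie algebras over `𝕜`. -/
structure IsLieTrivialization (e : Trivialization 𝔨 (π 𝔨 L)) : Prop where
  map_add : ∀ x ∈ e.baseSet, ∀ v w : L x, (e ⟨x, v + w⟩).2 = (e ⟨x, v⟩).2 + (e ⟨x, w⟩).2
  map_smul : ∀ x ∈ e.baseSet, ∀ (c : 𝕜) (v : L x), (e ⟨x, c • v⟩).2 = c • (e ⟨x, v⟩).2
  map_lie : ∀ x ∈ e.baseSet, ∀ v w : L x, (e ⟨x, ⁅v, w⁆⟩).2 = ⁅(e ⟨x, v⟩).2, (e ⟨x, w⟩).2⁆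

variable [∀ x, TopologicalSpace (L x)] [FiberBundle 𝔨 L]

/-- A bundle of Lie algebras over `𝕜` with fiber `𝔨`: the bracket of each fiber `L x` is the one
given by the bundle charts, i.e. all charts of the bundle atlas are fibrewise isomorphisms of Lie
algebras, so that the transition maps take values in `Aut(𝔨)`. -/
class LieAlgebraBundle : Prop where
  isLieTrivialization : ∀ (e : Trivialization 𝔨 (π 𝔨 L)) [MemTrivializationAtlas e],
    IsLieTrivialization 𝕜 e

variable {L}

variable {𝔨} in
theorem contDiff_smul_const [IsScalarTower ℝ 𝕜 𝔨] (c : 𝕜) {n : WithTop ℕ∞} :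
    ContDiff ℝ n fun v : 𝔨 => c • v :=
  ((c • ContinuousLinearMap.id 𝕜 𝔨 : 𝔨 →L[𝕜] 𝔨).restrictScalars ℝ).contDiff

variable {𝔨} in
theorem contDiff_bracket [FiniteDimensional 𝕜 𝔨] [IsScalarTower ℝ 𝕜 𝔨] {n : WithTop ℕ∞} :
    ContDiff ℝ n fun p : 𝔨 × 𝔨 => ⁅p.1, p.2⁆ := by
  let B : 𝔨 →L[𝕜] 𝔨 →L[𝕜] 𝔨 := LinearMap.toContinuousLinearMap
    ((LinearMap.toContinuousLinearMap : (𝔨 →ₗ[𝕜] 𝔨) ≃ₗ[𝕜] (𝔨 →L[𝕜] 𝔨)).toLinearMap ∘ₗ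
      LinearMap.mk₂ 𝕜 (fun x y : 𝔨 => ⁅x, y⁆) add_lie (fun c x y => smul_lie c x y)
        lie_add (fun c x y => lie_smul c x y))
  exact (B.isBoundedBilinearMap.contDiff (n := n)).restrict_scalars ℝ

variable (V L)

/-- The Lie algebra `Γ^k(L)` of `C^k` sections, with the pointwise operations. -/
def sections [FiniteDimensional 𝕜 𝔨] [IsScalarTower ℝ 𝕜 𝔨] [LieAlgebraBundle 𝕜 𝔨 L] (k : ℕ∞) :
    LieSubalgebra 𝕜 (∀ x, L x) where
  carrier := {X | ContMDiff 𝓘(ℝ, V) (𝓘(ℝ, V).prod 𝓘(ℝ, 𝔨)) k fun x => TotalSpace.mk' 𝔨 x (X x)}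
  add_mem' {X Y} hX hY := by
    refine fun x₀ => (contMDiffAt_section x₀).mpr ?_
    refine (((contMDiffAt_section x₀).mp (hX x₀)).add
      ((contMDiffAt_section x₀).mp (hY x₀))).congr_of_eventuallyEq ?_
    filter_upwards [(trivializationAt 𝔨 L x₀).open_baseSet.mem_nhds
      (FiberBundle.mem_baseSet_trivializationAt 𝔨 L x₀)] with x hx
    exact (LieAlgebraBundle.isLieTrivialization (𝕜 := 𝕜) _).map_add x hx _ _
  zero_mem' := by
    refine fun x₀ => (contMDiffAt_section x₀).mpr ?_
    refine (contMDiffAt_const (c := (0 : 𝔨))).congr_of_eventuallyEq ?_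
    filter_upwards [(trivializationAt 𝔨 L x₀).open_baseSet.mem_nhds
      (FiberBundle.mem_baseSet_trivializationAt 𝔨 L x₀)] with x hx
    simpa using (LieAlgebraBundle.isLieTrivialization (𝕜 := 𝕜) (trivializationAt 𝔨 L x₀)).map_smul
      x hx 0 0
  smul_mem' c X hX := by
    refine fun x₀ => (contMDiffAt_section x₀).mpr ?_
    refine ((contDiff_smul_const 𝕜 c).contMDiff.contMDiffAt.comp x₀
      ((contMDiffAt_section x₀).mp (hX x₀))).congr_of_eventuallyEq ?_
    filter_upwards [(trivializationAt 𝔨 L x₀).open_baseSet.mem_nhds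
      (FiberBundle.mem_baseSet_trivializationAt 𝔨 L x₀)] with x hx
    exact (LieAlgebraBundle.isLieTrivialization (𝕜 := 𝕜) _).map_smul x hx _ _
  lie_mem' {X Y} hX hY := by
    refine fun x₀ => (contMDiffAt_section x₀).mpr ?_
    refine ((contDiff_bracket 𝕜).contMDiff.contMDiffAt.comp x₀
      (((contMDiffAt_section x₀).mp (hX x₀)).prodMk_space
        ((contMDiffAt_section x₀).mp (hY x₀)))).congr_of_eventuallyEq ?_
    filter_upwards [(trivializationAt 𝔨 L x₀).open_baseSet.mem_nhds
      (FiberBundle.mem_baseSet_trivializationAt 𝔨 L x₀)] with x hx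
    exact (LieAlgebraBundle.isLieTrivialization (𝕜 := 𝕜) _).map_lie x hx _ _

variable {𝔨 L}

/-- The family `W` of ideals of the fibers is a subbundle of `L` with fiber the ideal `𝔧` of `𝔨`:
around every point there is a bundle chart of `L` (a smooth local trivialization with smooth inverse
that is fibrewise an isomorphism of Lie algebras) which maps `W x` onto `𝔧` for each `x` in its
domain, so that it restricts to a bundle chart of `W` with fiber `𝔧`. -/
def IsSubbundle (W : ∀ x, LieIdeal 𝕜 (L x)) (𝔧 : LieIdeal 𝕜 𝔨) : Prop :=
  ∀ x₀ : M, ∃ e : Trivialization 𝔨 (π 𝔨 L), x₀ ∈ e.baseSet ∧ IsLieTrivialization 𝕜 e ∧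
    ContMDiffOn (𝓘(ℝ, V).prod 𝓘(ℝ, 𝔨)) (𝓘(ℝ, V).prod 𝓘(ℝ, 𝔨)) ∞ e e.source ∧
    ContMDiffOn (𝓘(ℝ, V).prod 𝓘(ℝ, 𝔨)) (𝓘(ℝ, V).prod 𝓘(ℝ, 𝔨)) ∞
      e.toOpenPartialHomeomorph.symm e.target ∧
    ∀ x ∈ e.baseSet, ∀ v : L x, v ∈ W x ↔ (e ⟨x, v⟩).2 ∈ 𝔧

variable (𝔨) in
/-- The ideal `Γ^k(W)` of `Γ^k(L)` of those `C^k` sections that take values in `W`. -/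
def sectionsIn [FiniteDimensional 𝕜 𝔨] [IsScalarTower ℝ 𝕜 𝔨] [LieAlgebraBundle 𝕜 𝔨 L] (k : ℕ∞)
    (W : ∀ x, LieIdeal 𝕜 (L x)) : LieIdeal 𝕜 (sections 𝕜 V 𝔨 L k) where
  carrier := {X | ∀ x, X.1 x ∈ W x}
  add_mem' hX hY x := add_mem (hX x) (hY x)
  zero_mem' x := zero_mem (W x)
  smul_mem' c _ hX x := (W x).smul_mem c (hX x)
  lie_mem {X Y} hY x := lie_mem_right 𝕜 (L x) (W x) (X.1 x) (Y.1 x) (hY x)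

end Bundles

end LieSec

/-! Existence. In a perfect or centerfree Lie algebra the indecomposable summands are determined as
subsets (`IsIndecDecomp.exists_eq`), so automorphisms permute them and the class of an automorphism
in `QuotGroup` records only that permutation. This condition is both closed and open along a
continuous family (`isLocallyConstant_mk`), so the transition maps of the bundle define a Čech
cocycle in the discrete group. When it becomes a coboundary on a refinement, correcting the charts
by automorphisms makes all transitions preserve every summand; the ideals `W i x` of the fibers are
then well defined (`exists_isAdapted`). Fiberwise projections are constant linear maps in adapted
charts, so they split `C^k` sections as well. For simply connected `M` every cocycle is a
coboundary, because the associated covering space has a global section.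

Indecomposability. A splitting of one summand of the section algebra extends to a splitting of the
whole. The projection of such a splitting lies in the centroid, which is commutative here
(`centroid_commute`) and contains multiplication by functions. Hence the projection is linear over
functions, acts pointwise (`apply_eq_zero_of_commute`), and the splitting induces splittings of all
fibers (`isCompl_fiberIdeal`). Each `W i x` lies on one side; the side is locally constant in `x`,
and `M` is connected.

Uniqueness. This is the algebraic uniqueness statement, applied to the section algebra once that
algebra is known to be perfect or centerfree. Centerfreeness is checked pointwise. Perfectness needs
every section to be a finite sum of brackets even when `M` is not compact, which rests on the finite
generation of the module of smooth sections (`exists_fintype_span_eq_top`). The latter comes from a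
bound on the number of generators over compact sets, obtained by a Hausdorff dimension count. -/

namespace LieSec

/-! ### Centroids, projections and transport of decompositions -/

section Algebra

variable {𝕜 𝔤 : Type*} [CommRing 𝕜] [LieRing 𝔤] [LieAlgebra 𝕜 𝔤]

/-- Additive maps in the centroid of a perfect or centerfree Lie algebra commute. -/
theorem centroid_commute (hk : IsPerfect 𝕜 𝔤 ∨ IsCenterfree 𝕜 𝔤) (S T : 𝔤 →+ 𝔤)
    (hS : ∀ x y : 𝔤, S ⁅x, y⁆ = ⁅x, S y⁆) (hT : ∀ x y : 𝔤, T ⁅x, y⁆ = ⁅x, T y⁆) (x : 𝔤) :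
    S (T x) = T (S x) := by
  have flip : ∀ (R : 𝔤 →+ 𝔤), (∀ x y : 𝔤, R ⁅x, y⁆ = ⁅x, R y⁆) → ∀ x y : 𝔤, R ⁅x, y⁆ = ⁅R x, y⁆ := by
    intro R hR x y
    rw [← lie_skew, map_neg, hR, lie_skew]
  -- Centroid maps can act on either slot of a bracket, so both sides equal `⁅S x, T y⁆`.
  have key : ∀ x y : 𝔤, S (T ⁅x, y⁆) = T (S ⁅x, y⁆) := by
    intro x y
    rw [hT, flip S hS, flip S hS, hT]
  rcases hk with hp | hc
  · have hx : x ∈ ⁅(⊤ : LieIdeal 𝕜 𝔤), (⊤ : LieIdeal 𝕜 𝔤)⁆ := by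
      rw [show ⁅(⊤ : LieIdeal 𝕜 𝔤), (⊤ : LieIdeal 𝕜 𝔤)⁆ = ⊤ from hp]
      exact LieSubmodule.mem_top x
    rw [← LieSubmodule.mem_toSubmodule, LieSubmodule.lieIdeal_oper_eq_linear_span'] at hx
    -- `S` and `T` are only additive, so the scalars have to stay on the generators, where they are
    -- absorbed into a bracket.
    induction hx using Submodule.closure_induction with
    | zero => simp
    | add x y _ _ h1 h2 =>
      simp only [map_add]
      rw [h1, h2]
    | smul_mem c x h =>
      obtain ⟨a, -, b, -, rfl⟩ := h
      rw [← smul_lie, key]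
  · have : S (T x) - T (S x) ∈ LieAlgebra.center 𝕜 𝔤 := by
      rw [LieModule.mem_maxTrivSubmodule]
      intro y
      rw [lie_sub, ← hS, ← hT, ← hT, ← hS, key, sub_self]
    rw [show LieAlgebra.center 𝕜 𝔤 = ⊥ from hc, LieSubmodule.mem_bot] at this
    exact sub_eq_zero.mp this

theorem exists_mem_ne_zero {J : LieIdeal 𝕜 𝔤} (h : J ≠ ⊥) : ∃ x ∈ J, x ≠ 0 := by
  contrapose! h
  exact (LieSubmodule.eq_bot_iff J).mpr h

theorem lie_eq_zero_of_isCompl {C D : LieIdeal 𝕜 𝔤} (h : IsCompl C D) {c d : 𝔤} (hc : c ∈ C)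
    (hd : d ∈ D) : ⁅c, d⁆ = 0 := by
  have : ⁅c, d⁆ ∈ C ⊓ D := ⟨lie_mem_left 𝕜 𝔤 C c d hc, lie_mem_right 𝕜 𝔤 D c d hd⟩
  rwa [h.inf_eq_bot, LieSubmodule.mem_bot] at this

theorem eq_zero_of_mem_isCompl {C D : LieIdeal 𝕜 𝔤} (h : IsCompl C D) {c : 𝔤} (hc : c ∈ C)
    (hd : c ∈ D) : c = 0 := by
  have : c ∈ C ⊓ D := ⟨hc, hd⟩
  rwa [h.inf_eq_bot, LieSubmodule.mem_bot] at this

theorem exists_add_of_isCompl {C D : LieIdeal 𝕜 𝔤} (h : IsCompl C D) (x : 𝔤) :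
    ∃ c ∈ C, ∃ d ∈ D, c + d = x :=
  (LieSubmodule.mem_sup _ _ _).mp (h.sup_eq_top ▸ LieSubmodule.mem_top x : x ∈ C ⊔ D)

/-- The projection onto the first of two complementary ideals. -/
theorem exists_projection {C D : LieIdeal 𝕜 𝔤} (h : IsCompl C D) :
    ∃ p : 𝔤 →ₗ[𝕜] 𝔤, (∀ x y : 𝔤, p ⁅x, y⁆ = ⁅x, p y⁆) ∧ (∀ x ∈ C, p x = x) ∧
      (∀ x ∈ D, p x = 0) ∧ ∀ x, p x ∈ C := by
  choose c hc d hd hcd using exists_add_of_isCompl h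
  -- The chosen component is characterized by membership alone; linearity, equivariance and the
  -- values on `C` and `D` all follow from this.
  have uniq : ∀ x a, a ∈ C → x - a ∈ D → c x = a := by
    intro x a ha hxa
    refine sub_eq_zero.mp (eq_zero_of_mem_isCompl h (sub_mem (hc x) ha) ?_)
    have : c x - a = (x - a) - d x := by
      nth_rewrite 2 [← hcd x]
      abel
    rw [this]
    exact sub_mem hxa (hd x)
  have hcD : ∀ x, x - c x ∈ D := fun x => by
    have : x - c x = d x := by
      nth_rewrite 1 [← hcd x]
      abel
    rw [this]; exact hd x
  refine ⟨⟨⟨c, fun x y => uniq _ _ (add_mem (hc x) (hc y)) ?_⟩, fun r x => uniq _ _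
    (C.smul_mem r (hc x)) ?_⟩, fun x y => uniq _ _ (lie_mem_right 𝕜 𝔤 C _ _ (hc y)) ?_,
    fun x hx => uniq _ _ hx ?_, fun x hx => uniq _ _ (zero_mem _) ?_, hc⟩
  · rw [add_sub_add_comm]
    exact add_mem (hcD x) (hcD y)
  · change r • x - r • c x ∈ D
    rw [← smul_sub]
    exact D.smul_mem r (hcD x)
  · change ⁅x, y⁆ - ⁅x, c y⁆ ∈ D
    rw [← lie_sub]
    exact lie_mem_right 𝕜 𝔤 D _ _ (hcD y)
  · simp
  · simpa using hx

/-- An ideal of a direct summand, as an ideal of the whole Lie algebra. -/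
def liftIdeal {C D : LieIdeal 𝕜 𝔤} (h : IsCompl C D) (A : LieIdeal 𝕜 C) : LieIdeal 𝕜 𝔤 where
  __ := A.toSubmodule.map C.toSubmodule.subtype
  lie_mem {x a} ha := by
    obtain ⟨a, ha, rfl⟩ := ha
    obtain ⟨c, hc, d, hd, rfl⟩ := exists_add_of_isCompl h x
    refine ⟨⁅(⟨c, hc⟩ : C), a⁆, lie_mem_right 𝕜 C A _ _ ha, ?_⟩
    have : ⁅d, (a : 𝔤)⁆ = 0 := lie_eq_zero_of_isCompl h.symm hd a.2
    change ⁅c, (a : 𝔤)⁆ = ⁅c + d, (a : 𝔤)⁆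
    rw [add_lie, this, add_zero]

/-- The complement `D` is absorbed into the second piece. A splitting of a summand thus becomes a
splitting of the whole algebra, to which the centroid argument applies. -/
theorem isCompl_liftIdeal {C D : LieIdeal 𝕜 𝔤} (h : IsCompl C D) {A B : LieIdeal 𝕜 C}
    (hAB : IsCompl A B) : IsCompl (liftIdeal h A) (liftIdeal h B ⊔ D) := by
  refine ⟨disjoint_iff.mpr ?_, codisjoint_iff.mpr ?_⟩
  · rw [LieSubmodule.eq_bot_iff]
    rintro _ ⟨⟨a, ha, rfl⟩, hx⟩
    obtain ⟨_, ⟨b, hb, rfl⟩, d, hd, hbd⟩ := (LieSubmodule.mem_sup _ _ _).mp hx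
    change (b : 𝔤) + d = a at hbd
    have hd' : d = a - b := eq_sub_of_add_eq' hbd
    have hd0 : d = 0 := eq_zero_of_mem_isCompl h (hd' ▸ sub_mem a.2 b.2) hd
    rw [hd0, add_zero] at hbd
    have : b = a := Subtype.ext hbd
    rw [eq_zero_of_mem_isCompl hAB ha (this ▸ hb)]
    rfl
  · rw [eq_top_iff]
    rintro x -
    obtain ⟨c, hc, d, hd, rfl⟩ := exists_add_of_isCompl h x
    obtain ⟨a, ha, b, hb, hab⟩ := exists_add_of_isCompl hAB ⟨c, hc⟩
    refine (LieSubmodule.mem_sup _ _ _).mpr ⟨a, ⟨a, ha, rfl⟩, b + d,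
      (LieSubmodule.mem_sup _ _ _).mpr ⟨b, ⟨b, hb, rfl⟩, d, hd, rfl⟩, ?_⟩
    rw [← add_assoc]
    congr 1
    exact congrArg Subtype.val hab

theorem IsIndecDecomp.injective {ι : Type*} {I : ι → LieIdeal 𝕜 𝔤} (hI : IsIndecDecomp 𝕜 I) :
    Function.Injective I := by
  intro i j hij
  by_contra hne
  have h := (hI.independent.pairwiseDisjoint hne).eq_bot
  rw [← hij, inf_idem] at h
  exact hI.ne_bot i h

/-- Decompositions of a perfect or centerfree Lie algebra are unique up to order. -/
theorem IsIndecDecomp.exists_equiv (hk : IsPerfect 𝕜 𝔤 ∨ IsCenterfree 𝕜 𝔤) {ι κ : Type*}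
    {I : ι → LieIdeal 𝕜 𝔤} {J : κ → LieIdeal 𝕜 𝔤} (hI : IsIndecDecomp 𝕜 I)
    (hJ : IsIndecDecomp 𝕜 J) : ∃ σ : κ ≃ ι, ∀ j, J j = I (σ j) := by
  choose f hf using hI.exists_eq hk hJ
  refine ⟨Equiv.ofBijective f ⟨fun a b hab => hJ.injective (by rw [hf, hf, hab]), fun i => ?_⟩, hf⟩
  obtain ⟨j, hj⟩ := hJ.exists_eq hk hI i
  exact ⟨j, hI.injective (by rw [← hf, hj])⟩

variable {𝔥 : Type*} [LieRing 𝔥] [LieAlgebra 𝕜 𝔥]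

theorem IsPerfect.of_equiv (e : 𝔤 ≃ₗ⁅𝕜⁆ 𝔥) (h : IsPerfect 𝕜 𝔤) : IsPerfect 𝕜 𝔥 := by
  rw [IsPerfect, eq_top_iff]
  rintro y -
  have hy : e.symm y ∈ ⁅(⊤ : LieIdeal 𝕜 𝔤), (⊤ : LieIdeal 𝕜 𝔤)⁆ := by
    rw [show ⁅(⊤ : LieIdeal 𝕜 𝔤), (⊤ : LieIdeal 𝕜 𝔤)⁆ = ⊤ from h]
    exact LieSubmodule.mem_top _
  rw [← LieSubmodule.mem_toSubmodule, LieSubmodule.lieIdeal_oper_eq_linear_span'] at hy ⊢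
  have := Submodule.mem_map_of_mem (f := (e.toLinearEquiv : 𝔤 →ₗ[𝕜] 𝔥)) hy
  rw [Submodule.map_span] at this
  have h2 : e.toLinearEquiv (e.symm y) = y := e.apply_symm_apply y
  refine Submodule.span_mono ?_ (h2 ▸ this)
  rintro _ ⟨_, ⟨a, -, b, -, rfl⟩, rfl⟩
  exact ⟨e a, LieSubmodule.mem_top _, e b, LieSubmodule.mem_top _, (e.map_lie a b).symm⟩

theorem IsCenterfree.of_equiv (e : 𝔤 ≃ₗ⁅𝕜⁆ 𝔥) (h : IsCenterfree 𝕜 𝔤) : IsCenterfree 𝕜 𝔥 := by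
  rw [IsCenterfree, LieSubmodule.eq_bot_iff]
  intro y hy
  rw [LieModule.mem_maxTrivSubmodule] at hy
  have : e.symm y ∈ LieAlgebra.center 𝕜 𝔤 := by
    rw [LieModule.mem_maxTrivSubmodule]
    intro x
    apply e.injective
    have h1 : e ⁅x, e.symm y⁆ = ⁅e x, e (e.symm y)⁆ := e.map_lie _ _
    have h2 : e (0 : 𝔤) = 0 := map_zero e.toLinearEquiv
    exact (h1.trans (by rw [e.apply_symm_apply, hy])).trans h2.symm
  rw [show LieAlgebra.center 𝕜 𝔤 = ⊥ from h, LieSubmodule.mem_bot] at this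
  rw [← e.apply_symm_apply y, this, map_zero]

theorem isPerfect_or_isCenterfree_of_equiv (e : 𝔤 ≃ₗ⁅𝕜⁆ 𝔥)
    (h : IsPerfect 𝕜 𝔤 ∨ IsCenterfree 𝕜 𝔤) : IsPerfect 𝕜 𝔥 ∨ IsCenterfree 𝕜 𝔥 :=
  h.imp (.of_equiv e) (.of_equiv e)

/-- Indecomposability is not assumed, so this is available while the summands of the section algebra
are still being shown indecomposable. -/
theorem isCompl_of_iSupIndep {ι : Type*} {I : ι → LieIdeal 𝕜 𝔤} (hI : iSupIndep I)
    (htop : ⨆ i, I i = ⊤) (i : ι) : IsCompl (I i) (⨆ (j) (_ : j ≠ i), I j) := by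
  refine ⟨hI i, codisjoint_iff.mpr (top_le_iff.mp ?_)⟩
  rw [← htop]
  refine iSup_le fun j => ?_
  by_cases hj : j = i
  · subst hj; exact le_sup_left
  · exact le_sup_of_le_right (le_iSup₂_of_le j hj le_rfl)

/-- The projections onto the summands of a decomposition. -/
theorem IsIndecDecomp.exists_projections {ι : Type*} [Fintype ι] {I : ι → LieIdeal 𝕜 𝔤}
    (hI : IsIndecDecomp 𝕜 I) : ∃ p : ι → 𝔤 →ₗ[𝕜] 𝔤, (∀ i x, p i x ∈ I i) ∧
      (∀ i, ∀ x ∈ I i, p i x = x) ∧ (∀ i j, j ≠ i → ∀ x ∈ I j, p i x = 0) ∧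
      ∀ x, ∑ i, p i x = x := by
  classical
  choose p _ h1 h2 h3 using fun i => exists_projection (hI.isCompl i)
  have h0 : ∀ i j, j ≠ i → ∀ x ∈ I j, p i x = 0 := fun i j hj x hx =>
    h2 i x (le_iSup₂ (f := fun (j : ι) (_ : j ≠ i) => I j) j hj hx)
  refine ⟨p, h3, h1, h0, fun x => ?_⟩
  have hx : x ∈ ⨆ i, I i := hI.iSup_eq_top ▸ LieSubmodule.mem_top x
  refine LieSubmodule.iSup_induction I (motive := fun x => ∑ i, p i x = x) hx ?_ ?_ ?_
  · intro i x hx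
    rw [Finset.sum_eq_single i (fun j _ hj => h0 j i hj.symm x hx) (by simp), h1 i x hx]
  · simp
  · intro x y hx hy
    simp only [map_add, Finset.sum_add_distrib, hx, hy]

/-- Projections of corresponding decompositions correspond to each other. -/
theorem IsIndecDecomp.apply_projection {ι : Type*} {I : ι → LieIdeal 𝕜 𝔤} {J : ι → LieIdeal 𝕜 𝔥}
    (hI : IsIndecDecomp 𝕜 I) (e : 𝔤 ≃ₗ⁅𝕜⁆ 𝔥) (he : ∀ i x, x ∈ I i ↔ e x ∈ J i) (i : ι)
    {p : 𝔤 →ₗ[𝕜] 𝔤} (hp : ∀ x ∈ I i, p x = x) (hp' : ∀ j, j ≠ i → ∀ x ∈ I j, p x = 0)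
    {q : 𝔥 →ₗ[𝕜] 𝔥} (hq : ∀ x ∈ J i, q x = x) (hq' : ∀ j, j ≠ i → ∀ x ∈ J j, q x = 0) (x : 𝔤) :
    e (p x) = q (e x) := by
  have hx : x ∈ ⨆ i, I i := hI.iSup_eq_top ▸ LieSubmodule.mem_top x
  have hadd : ∀ a b : 𝔤, e (a + b) = e a + e b := map_add e.toLinearEquiv
  have hzero : e (0 : 𝔤) = 0 := map_zero e.toLinearEquiv
  refine LieSubmodule.iSup_induction I (motive := fun x => e (p x) = q (e x)) hx ?_ ?_ ?_
  · intro j x hx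
    by_cases hj : j = i
    · subst hj
      rw [hp x hx, hq _ ((he j x).mp hx)]
    · rw [hp' j hj x hx, hq' j hj _ ((he j x).mp hx), hzero]
  · rw [map_zero, hzero, map_zero]
  · intro x y hx hy
    rw [map_add, hadd, hadd, map_add, hx, hy]

/-- The isomorphism from the preimage of an ideal under an isomorphism onto the ideal. -/
def preimageEquiv (e : 𝔤 ≃ₗ⁅𝕜⁆ 𝔥) (J : LieIdeal 𝕜 𝔥) : J ≃ₗ⁅𝕜⁆ comapOrderIso e J where
  toFun x := ⟨e.symm x, LieIdeal.mem_comap.mpr (by simp)⟩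
  invFun x := ⟨e x, LieIdeal.mem_comap.mp x.2⟩
  map_add' x y := Subtype.ext (by simp)
  map_smul' c x := Subtype.ext (by simp)
  map_lie' {x y} := Subtype.ext (e.symm.map_lie x.1 y.1)
  left_inv x := Subtype.ext (by simp)
  right_inv x := Subtype.ext (by simp)

theorem IsIndecDecomp.of_equiv {ι : Type*} {I : ι → LieIdeal 𝕜 𝔤} {J : ι → LieIdeal 𝕜 𝔥}
    (hJ : IsIndecDecomp 𝕜 J) (e : 𝔤 ≃ₗ⁅𝕜⁆ 𝔥) (he : ∀ i x, x ∈ I i ↔ e x ∈ J i) :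
    IsIndecDecomp 𝕜 I := by
  obtain rfl : I = fun i => comapOrderIso e (J i) := by
    funext i
    ext x
    exact he i x
  exact
  { independent := hJ.independent.map_orderIso (comapOrderIso e)
    iSup_eq_top := by rw [← OrderIso.map_iSup, hJ.iSup_eq_top, OrderIso.map_top]
    ne_bot := fun i => by simpa using hJ.ne_bot i
    indecomposable := fun i => (hJ.indecomposable i).of_equiv (preimageEquiv e (J i)) }

end Algebra

/-! ### σ-compactness, and vanishing of Čech cohomology via covering spaces -/

section Topology

/-- Connected paracompact weakly locally compact spaces are `σ`-compact. -/
theorem sigmaCompactSpace_of_connected (X : Type*) [TopologicalSpace X] [T2Space X]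
    [ParacompactSpace X] [ConnectedSpace X] [WeaklyLocallyCompactSpace X] : SigmaCompactSpace X := by
  choose K hK hKn using fun x : X => exists_compact_mem_nhds x
  obtain ⟨v, hvo, hvc, hvf, hvK⟩ := precise_refinement (fun x => interior (K x))
    (fun _ => isOpen_interior)
    (Set.eq_univ_of_forall fun x => Set.mem_iUnion_of_mem x (mem_interior_iff_mem_nhds.mpr (hKn x)))
  have hvcpt : ∀ i, IsCompact (closure (v i)) := fun i =>
    (hK i).of_isClosed_subset isClosed_closure
      (closure_minimal ((hvK i).trans interior_subset) (hK i).isClosed)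
  -- By local finiteness a compact set meets finitely many members of the cover, so its star is
  -- again compact. Iterating from a point exhausts the connected space.
  let star : Set X → Set X := fun s => ⋃ i ∈ {i | (v i ∩ s).Nonempty}, closure (v i)
  have hstar : ∀ s, IsCompact s → IsCompact (star s) := fun s hs =>
    (hvf.finite_nonempty_inter_compact hs).isCompact_biUnion fun i _ => hvcpt i
  let C : ℕ → Set X := fun n => star^[n] {Classical.arbitrary X}
  have hC : ∀ n, IsCompact (C n) := by
    intro n
    induction n with
    | zero => exact isCompact_singleton
    | succ n ih =>
      simp only [C, Function.iterate_succ_apply']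
      exact hstar _ ih
  have hmem : ∀ n i, (v i ∩ C n).Nonempty → v i ⊆ C (n + 1) := by
    intro n i hi x hx
    simp only [C, Function.iterate_succ_apply']
    exact Set.mem_biUnion (show i ∈ {i | (v i ∩ C n).Nonempty} from hi) (subset_closure hx)
  -- A member of the cover that meets `C n` lies in `C (n + 1)`. Every point of the union or of its
  -- closure lies in some such member.
  have hclopen : IsClopen (⋃ n, C n) := by
    refine ⟨isClosed_of_closure_subset fun x hx => ?_, isOpen_iff_mem_nhds.mpr fun x hx => ?_⟩
    · obtain ⟨i, hi⟩ := Set.mem_iUnion.mp (hvc ▸ Set.mem_univ x)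
      obtain ⟨y, hy, hyC⟩ := mem_closure_iff.mp hx _ (hvo i) hi
      obtain ⟨n, hn⟩ := Set.mem_iUnion.mp hyC
      exact Set.mem_iUnion_of_mem (n + 1) (hmem n i ⟨y, hy, hn⟩ hi)
    · obtain ⟨i, hi⟩ := Set.mem_iUnion.mp (hvc ▸ Set.mem_univ x)
      obtain ⟨n, hn⟩ := Set.mem_iUnion.mp hx
      exact Filter.mem_of_superset ((hvo i).mem_nhds hi)
        ((hmem n i ⟨x, hi, hn⟩).trans (Set.subset_iUnion C (n + 1)))
  refine ⟨C, hC, hclopen.eq_univ ⟨Classical.arbitrary X, Set.mem_iUnion_of_mem 0 rfl⟩⟩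

variable {M : Type*} [TopologicalSpace M] {G : Type*} [Group G]

theorem Cocycle.val_self {𝔙 : OpenCov M} (g : Cocycle G 𝔙) (U : 𝔙.sets) (x : M) (hU : x ∈ U.1) :
    g.val U U ⟨x, hU, hU⟩ = 1 := by
  simpa using g.cocycle U U U x hU hU hU

/-- The trivial cocycle. -/
def Cocycle.trivial (𝔙 : OpenCov M) : Cocycle G 𝔙 where
  val _ _ := LocallyConstant.const _ 1
  cocycle _ _ _ _ _ _ _ := by simp

open scoped Classical in
/-- The principal bundle with discrete structure group defined by a cocycle. -/
noncomputable def Cocycle.core [TopologicalSpace G] [DiscreteTopology G] {𝔙 : OpenCov M} (g : Cocycle G 𝔙) :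
    FiberBundleCore 𝔙.sets M G where
  baseSet U := U.1
  isOpen_baseSet U := U.1.2
  indexAt x := ⟨(𝔙.covers x).choose, (𝔙.covers x).choose_spec.1⟩
  mem_baseSet_at x := (𝔙.covers x).choose_spec.2
  coordChange U V x a := if h : x ∈ U.1 ⊓ V.1 then g.val V U ⟨x, h⟩ * a else a
  coordChange_self U x hx a := by
    have h : x ∈ U.1 ⊓ U.1 := ⟨hx, hx⟩
    rw [dif_pos h, g.val_self U x hx, one_mul]
  continuousOn_coordChange U V := by
    rw [continuousOn_iff_continuous_domRestrict]
    have : Continuous fun p : ((U.1 : Set M) ∩ V.1) ×ˢ (Set.univ : Set G) =>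
        g.val V U ⟨p.1.1, p.2.1⟩ * p.1.2 :=
      ((g.val V U).continuous.comp (by fun_prop)).mul (by fun_prop)
    refine this.congr fun p => ?_
    have h : p.1.1 ∈ U.1 ⊓ V.1 := p.2.1
    rw [Set.domRestrict_apply, dif_pos h]
  coordChange_comp U V W x hx a := by
    have h1 : x ∈ U.1 ⊓ V.1 := hx.1
    have h2 : x ∈ V.1 ⊓ W.1 := ⟨hx.1.2, hx.2⟩
    have h3 : x ∈ U.1 ⊓ W.1 := ⟨hx.1.1, hx.2⟩
    simp only [dif_pos h1, dif_pos h2, dif_pos h3]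
    rw [← mul_assoc, g.cocycle V W U x h1.2 h2.2 h1.1]

/-- On a simply connected, locally path connected space, all cocycles with values in a discrete
group are coboundaries. -/
theorem Cocycle.cohomologous_trivial [SimplyConnectedSpace M] [LocallyPathConnectedSpace M]
    {𝔙 : OpenCov M} (g : Cocycle G 𝔙) : (Cocycle.trivial 𝔙).Cohomologous g := by
  let _ : TopologicalSpace G := ⊥
  have : DiscreteTopology G := ⟨rfl⟩
  let Z := g.core
  have cov : IsCoveringMap (π G Z.Fiber) := FiberBundle.isCoveringMap
  let x₀ : M := Classical.arbitrary M
  -- Lifting the identity through the covering gives a global section. Its coordinates `h_U` over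
  -- the members of the cover satisfy `g_VU h_U = h_V`, which exhibits `g` as a coboundary.
  obtain ⟨s, ⟨-, hs⟩, -⟩ := cov.existsUnique_continuousMap_lifts (ContinuousMap.id M) x₀
    (⟨x₀, (1 : G)⟩ : TotalSpace G Z.Fiber) rfl
  have hs' : ∀ x, (s x).1 = x := fun x => congrFun hs x
  have hcont : ∀ U : 𝔙.sets, Continuous fun x : U.1 => (Z.localTriv U (s x)).2 := by
    intro U
    have h1 : Continuous fun x : U.1 => Z.localTriv U (s x) :=
      (Z.localTriv U).continuousOn.comp_continuous (s.continuous.comp continuous_subtype_val)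
        fun x => by
          rw [Trivialization.mem_source]
          exact (hs' x).symm ▸ x.2
    exact continuous_snd.comp h1
  refine ⟨fun U => ⟨fun x => (Z.localTriv U (s x)).2,
    (IsLocallyConstant.iff_continuous _).mpr (hcont U)⟩, fun U V x hU hV => ?_⟩
  change g.val V U ⟨x, hU, hV⟩ = (Z.localTriv V (s x)).2 * 1 * ((Z.localTriv U (s x)).2)⁻¹
  rw [mul_one, eq_mul_inv_iff_mul_eq]
  obtain ⟨y, hy⟩ : ∃ y : G, s x = ⟨x, y⟩ := by
    have := hs' x
    generalize s x = e at this ⊢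
    obtain ⟨x', y⟩ := e
    cases this
    exact ⟨y, rfl⟩
  have hi : x ∈ (Z.indexAt x).1 := Z.mem_baseSet_at x
  have h1 : x ∈ (Z.indexAt x).1 ⊓ U.1 := ⟨hi, hU⟩
  have h2 : x ∈ (Z.indexAt x).1 ⊓ V.1 := ⟨hi, hV⟩
  have e1 : (Z.localTriv U (s x)).2 = g.val U (Z.indexAt x) ⟨x, h1⟩ * y := by
    rw [hy]; exact dif_pos h1
  have e2 : (Z.localTriv V (s x)).2 = g.val V (Z.indexAt x) ⟨x, h2⟩ * y := by
    rw [hy]; exact dif_pos h2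
  rw [e1, e2, ← mul_assoc, g.cocycle U V _ x hU hV hi]

theorem subsingleton_cechH1 [SimplyConnectedSpace M] [LocallyPathConnectedSpace M] :
    Subsingleton (CechH1 M G) := by
  refine ⟨fun a b => ?_⟩
  induction a using Quotient.inductionOn with | _ a =>
  induction b using Quotient.inductionOn with | _ b =>
  refine Quotient.sound ?_
  obtain ⟨𝔘, ⟨p⟩, ⟨q⟩⟩ := a.1.exists_common b.1
  exact ⟨𝔘, p, q, (a.2.pullback p).cohomologous_trivial.symm.trans
    (b.2.pullback q).cohomologous_trivial⟩

/-- If the first Čech cohomology set is trivial, then every cocycle becomes a coboundary on some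
refinement. -/
theorem Cocycle.exists_trivialization [Subsingleton (CechH1 M G)] {𝔙 : OpenCov M}
    (g : Cocycle G 𝔙) : ∃ (𝔘 : OpenCov M) (f : Refinement 𝔘 𝔙)
      (h : ∀ U : 𝔘.sets, LocallyConstant ↥U.1 G), ∀ (U V : 𝔘.sets) (x : M) (hU : x ∈ U.1)
        (hV : x ∈ V.1),
        h V ⟨x, hV⟩ * g.val (f.map V) (f.map U) ⟨x, f.le U hU, f.le V hV⟩ = h U ⟨x, hU⟩ := by
  have : (Quotient.mk (cechSetoid M G) ⟨𝔙, g⟩ : CechH1 M G) =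
    Quotient.mk (cechSetoid M G) ⟨𝔙, Cocycle.trivial 𝔙⟩ := Subsingleton.elim (α := CechH1 M G) _ _
  obtain ⟨𝔘, f, f', h, hh⟩ := Quotient.exact this
  refine ⟨𝔘, f, h, fun U V x hU hV => ?_⟩
  have := hh U V x hU hV
  exact (mul_inv_eq_one.mp this.symm)

end Topology

/-! ### The discrete quotient group and local constancy of classes -/

section Quot

variable {𝕜 𝔤 : Type*} [CommRing 𝕜] [LieRing 𝔤] [LieAlgebra 𝕜 𝔤] {ι : Type*}
  {I : ι → LieIdeal 𝕜 𝔤} {hk : IsPerfect 𝕜 𝔤 ∨ IsCenterfree 𝕜 𝔤} {hI : IsIndecDecomp 𝕜 I}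

variable (hk hI) in
/-- The quotient map from `Aut(𝔤)` to `G(𝔤)`. -/
def QuotGroup.mk : autGroup 𝕜 𝔤 →* QuotGroup I hk hI :=
  haveI := stabGroup_normal hk hI
  QuotientGroup.mk' (stabGroup I)

theorem QuotGroup.mk_surjective : Function.Surjective (QuotGroup.mk hk hI) :=
  haveI := stabGroup_normal hk hI
  QuotientGroup.mk'_surjective (stabGroup I)

theorem QuotGroup.mk_eq_one {a : autGroup 𝕜 𝔤} : QuotGroup.mk hk hI a = 1 ↔ a ∈ stabGroup I :=
  haveI := stabGroup_normal hk hI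
  QuotientGroup.eq_one_iff a

theorem mem_stabGroup_iff {a : autGroup 𝕜 𝔤} :
    a ∈ stabGroup I ↔ ∀ i v, a.1 v ∈ I i ↔ v ∈ I i := by
  have : a ∈ stabGroup I ↔ ∀ i, a.1 '' (I i : Set 𝔤) = I i := Iff.rfl
  rw [this]
  refine forall_congr' fun i => ?_
  rw [eq_comm, ← Set.preimage_eq_iff_eq_image a.1.bijective, Set.ext_iff]
  rfl

/-- The quotient `a * b⁻¹` stabilizes every `I i` exactly when `a` and `b` pull each `I i` back to
the same ideal. Identities between classes thereby become statements about membership in the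
summands. -/
theorem QuotGroup.mk_eq_mk {a b : autGroup 𝕜 𝔤} :
    QuotGroup.mk hk hI a = QuotGroup.mk hk hI b ↔ ∀ i v, a.1 v ∈ I i ↔ b.1 v ∈ I i := by
  rw [← mul_inv_eq_one, ← map_inv, ← map_mul, QuotGroup.mk_eq_one, mem_stabGroup_iff]
  refine forall_congr' fun i => ⟨fun h v => ?_, fun h v => ?_⟩
  · have := h (b.1 v)
    have e : (a * b⁻¹).1 (b.1 v) = a.1 v := congrArg a.1 (b.1.symm_apply_apply v)
    rwa [e] at this
  · have := h (b.1.symm v)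
    rwa [b.1.apply_symm_apply] at this

/-- A pointwise continuous family of automorphisms has a locally constant class in `G(𝔤)`, if
the ideals of the decomposition are closed. -/
theorem isLocallyConstant_mk [Finite ι] [TopologicalSpace 𝔤] (hcl : ∀ i, IsClosed (I i : Set 𝔤))
    {X : Type*} [TopologicalSpace X] (f : X → autGroup 𝕜 𝔤)
    (hf : ∀ v, Continuous fun x => (f x).1 v) :
    IsLocallyConstant fun x => QuotGroup.mk hk hI (f x) := by
  -- By uniqueness of the decomposition, `f x` pulls the summand `I i` back to another summand,
  -- whose index is `τ x i`.
  have hτ : ∀ x i, ∃ l, ∀ v, (f x).1 v ∈ I i ↔ v ∈ I l := by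
    intro x i
    obtain ⟨l, hl⟩ := hI.exists_eq hk (hI.comap (autGroup.toLieEquiv (f x))) i
    refine ⟨l, fun v => ?_⟩
    rw [← hl]
    rfl
  choose τ hτ using hτ
  -- Distinct summands are disjoint and nonzero, so `I l ≤ I (τ x i)` already forces equality of the
  -- indices. The inclusion is a closed condition on `x`.
  have hfib : ∀ i l, {x | τ x i = l} = ⋂ v ∈ I l, (fun x => (f x).1 v) ⁻¹' (I i) := by
    intro i l
    ext x
    simp only [Set.mem_ofPred_eq, Set.mem_iInter, Set.mem_preimage, SetLike.mem_coe, hτ]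
    refine ⟨fun h v hv => h ▸ hv, fun h => ?_⟩
    by_contra hne
    have hle : I l ≤ I (τ x i) := h
    exact hI.ne_bot l (((hI.independent.pairwiseDisjoint hne).symm.eq_bot_of_le hle))
  have hclosed : ∀ i l, IsClosed {x | τ x i = l} := by
    intro i l
    rw [hfib]
    exact isClosed_biInter fun v _ => (hcl i).preimage (hf v)
  have hloc : ∀ i, IsLocallyConstant fun x => τ x i := by
    intro i
    rw [IsLocallyConstant.iff_isOpen_fiber]
    intro l
    -- With finitely many indices the complement of a fiber is a finite union of closed sets, so
    -- each fiber is open as well.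
    have : {x | τ x i = l}ᶜ = ⋃ l' ∈ {l' | l' ≠ l}, {x | τ x i = l'} := by
      ext x; simp
    rw [← isClosed_compl_iff]
    change IsClosed {x | τ x i = l}ᶜ
    rw [this]
    exact (Set.toFinite _).isClosed_biUnion fun l' _ => hclosed i l'
  rw [IsLocallyConstant.iff_eventually_eq]
  intro x
  have : ∀ᶠ y in nhds x, ∀ i, τ y i = τ x i :=
    Filter.eventually_all.mpr fun i => (IsLocallyConstant.iff_eventually_eq _).mp (hloc i) x
  filter_upwards [this] with y hy
  rw [QuotGroup.mk_eq_mk]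
  intro i v
  rw [hτ, hτ, hy]

/-- A Lie algebra automorphism as an element of `Aut(𝔤)`. -/
def autGroup.ofLieEquiv (e : 𝔤 ≃ₗ⁅𝕜⁆ 𝔤) : autGroup 𝕜 𝔤 := ⟨e.toLinearEquiv, fun _ _ => e.map_lie _ _⟩

end Quot

/-! ### Transition cocycle and adapted charts -/

section Bundles

variable {𝕜 : Type*} [RCLike 𝕜]
  {V : Type*} [NormedAddCommGroup V] [NormedSpace ℝ V]
  {M : Type*} [TopologicalSpace M] [ChartedSpace V M]
  {𝔨 : Type*} [NormedLieRing 𝔨] [NormedLieAlgebra 𝕜 𝔨]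
  {L : M → Type*} [∀ x, LieRing (L x)] [∀ x, LieAlgebra 𝕜 (L x)]
  [TopologicalSpace (TotalSpace 𝔨 L)]

/-- The isomorphism of a fiber with `𝔨` defined by a bundle chart. -/
noncomputable def IsLieTrivialization.lieEquivAt {e : Trivialization 𝔨 (π 𝔨 L)}
    (he : IsLieTrivialization 𝕜 e) {x : M} (hx : x ∈ e.baseSet) : L x ≃ₗ⁅𝕜⁆ 𝔨 where
  toFun v := (e ⟨x, v⟩).2
  invFun w := e.symm x w
  map_add' := he.map_add x hx
  map_smul' := he.map_smul x hx
  map_lie' := he.map_lie x hx _ _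
  left_inv v := e.symm_apply_apply_mk hx v
  right_inv w := by
    change (e ⟨x, e.symm x w⟩).2 = w
    rw [e.apply_mk_symm hx]

/-- Transition maps of bundle charts, as elements of `Aut(𝔨)`. -/
noncomputable def IsLieTrivialization.transition {e e' : Trivialization 𝔨 (π 𝔨 L)}
    (he : IsLieTrivialization 𝕜 e) (he' : IsLieTrivialization 𝕜 e') {x : M} (hx : x ∈ e.baseSet)
    (hx' : x ∈ e'.baseSet) : autGroup 𝕜 𝔨 :=
  autGroup.ofLieEquiv ((he.lieEquivAt hx).symm.trans (he'.lieEquivAt hx'))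

theorem IsLieTrivialization.transition_apply {e e' : Trivialization 𝔨 (π 𝔨 L)}
    (he : IsLieTrivialization 𝕜 e) (he' : IsLieTrivialization 𝕜 e') {x : M} (hx : x ∈ e.baseSet)
    (hx' : x ∈ e'.baseSet) (w : 𝔨) :
    (he.transition he' hx hx').1 w = (e' ⟨x, e.symm x w⟩).2 := rfl

theorem IsLieTrivialization.transition_lieEquivAt {e e' : Trivialization 𝔨 (π 𝔨 L)}
    (he : IsLieTrivialization 𝕜 e) (he' : IsLieTrivialization 𝕜 e') {x : M} (hx : x ∈ e.baseSet)
    (hx' : x ∈ e'.baseSet) (v : L x) :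
    (he.transition he' hx hx').1 (he.lieEquivAt hx v) = he'.lieEquivAt hx' v :=
  congrArg (he'.lieEquivAt hx') ((he.lieEquivAt hx).symm_apply_apply v)

theorem IsLieTrivialization.transition_mul {e e' e'' : Trivialization 𝔨 (π 𝔨 L)}
    (he : IsLieTrivialization 𝕜 e) (he' : IsLieTrivialization 𝕜 e')
    (he'' : IsLieTrivialization 𝕜 e'') {x : M} (hx : x ∈ e.baseSet)
    (hx' : x ∈ e'.baseSet) (hx'' : x ∈ e''.baseSet) :
    he'.transition he'' hx' hx'' * he.transition he' hx hx' = he.transition he'' hx hx'' := by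
  apply Subtype.ext
  ext w
  obtain ⟨v, rfl⟩ := (he.lieEquivAt hx).surjective w
  change (he'.transition he'' hx' hx'').1 ((he.transition he' hx hx').1 (he.lieEquivAt hx v)) = _
  exact ((congrArg _ (he.transition_lieEquivAt he' hx hx' v)).trans
    (he'.transition_lieEquivAt he'' hx' hx'' v)).trans
    (he.transition_lieEquivAt he'' hx hx'' v).symm

theorem IsLieTrivialization.continuous_transition {e e' : Trivialization 𝔨 (π 𝔨 L)}
    (he : IsLieTrivialization 𝕜 e) (he' : IsLieTrivialization 𝕜 e') {X : Type*}
    [TopologicalSpace X] {f : X → M} (hf : Continuous f) (hx : ∀ x, f x ∈ e.baseSet)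
    (hx' : ∀ x, f x ∈ e'.baseSet) (w : 𝔨) :
    Continuous fun x => (he.transition he' (hx x) (hx' x)).1 w := by
  simp only [IsLieTrivialization.transition_apply, e.mk_symm (hx _)]
  refine continuous_snd.comp (e'.continuousOn.comp_continuous
    (e.toOpenPartialHomeomorph.continuousOn_symm.comp_continuous
      (hf.prodMk continuous_const) fun x => e.mem_target.mpr (hx x)) fun x => ?_)
  rw [Trivialization.mem_source, e.proj_symm_apply' (hx x)]
  exact hx' x

variable [∀ x, TopologicalSpace (L x)] [FiberBundle 𝔨 L] [LieAlgebraBundle 𝕜 𝔨 L]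

variable (𝕜 𝔨 L) in
/-- The bundle chart at a point is fibrewise an isomorphism of Lie algebras. -/
theorem isLieTrivialization_trivializationAt (x : M) :
    IsLieTrivialization 𝕜 (trivializationAt 𝔨 L x) :=
  LieAlgebraBundle.isLieTrivialization _

variable (𝔨 L) in
/-- The cover by the domains of the bundle charts. -/
def chartCover : OpenCov M where
  sets := Set.range fun x => ⟨(trivializationAt 𝔨 L x).baseSet, (trivializationAt 𝔨 L x).open_baseSet⟩
  covers x := ⟨_, ⟨x, rfl⟩, FiberBundle.mem_baseSet_trivializationAt 𝔨 L x⟩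

variable (𝔨 L) in
/-- A bundle chart with the given domain. -/
noncomputable def chartOf (U : (chartCover 𝔨 L).sets) : Trivialization 𝔨 (π 𝔨 L) :=
  trivializationAt 𝔨 L U.2.choose

instance (U : (chartCover 𝔨 L).sets) : MemTrivializationAtlas (chartOf 𝔨 L U) :=
  inferInstanceAs (MemTrivializationAtlas (trivializationAt 𝔨 L U.2.choose))

variable (𝕜) in
theorem isLieTrivialization_chartOf (U : (chartCover 𝔨 L).sets) :
    IsLieTrivialization 𝕜 (chartOf 𝔨 L U) :=
  isLieTrivialization_trivializationAt 𝕜 𝔨 L _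

omit [∀ x, LieRing (L x)] in
theorem mem_baseSet_chartOf {U : (chartCover 𝔨 L).sets} {x : M} :
    x ∈ (chartOf 𝔨 L U).baseSet ↔ x ∈ U.1 := by
  conv_rhs => rw [← U.2.choose_spec]
  rfl

theorem isClosed_lieIdeal [FiniteDimensional 𝕜 𝔨] (𝔧 : LieIdeal 𝕜 𝔨) :
    IsClosed (𝔧 : Set 𝔨) :=
  𝔧.toSubmodule.closed_of_finiteDimensional

variable {ι : Type*} [Finite ι] {I : ι → LieIdeal 𝕜 𝔨}
  (hk : IsPerfect 𝕜 𝔨 ∨ IsCenterfree 𝕜 𝔨) (hI : IsIndecDecomp 𝕜 I)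

variable (L) in
/-- The cocycle in `G(𝔨)` defined by the transition maps of the bundle. -/
noncomputable def transitionCocycle [FiniteDimensional 𝕜 𝔨] :
    Cocycle (QuotGroup I hk hI) (chartCover 𝔨 L) where
  val V U := ⟨fun x => QuotGroup.mk hk hI ((isLieTrivialization_chartOf 𝕜 U).transition
      (isLieTrivialization_chartOf 𝕜 V) (mem_baseSet_chartOf.mpr x.2.1)
      (mem_baseSet_chartOf.mpr x.2.2)),
    isLocallyConstant_mk (fun i => isClosed_lieIdeal (I i)) _ fun w =>
      (isLieTrivialization_chartOf 𝕜 U).continuous_transition (isLieTrivialization_chartOf 𝕜 V)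
        continuous_subtype_val _ _ w⟩
  cocycle U V W x hU hV hW := by
    change QuotGroup.mk hk hI _ * QuotGroup.mk hk hI _ = QuotGroup.mk hk hI _
    rw [← map_mul]
    congr 1
    exact IsLieTrivialization.transition_mul _ _ _ _ _ _

/-- Around every point there is a bundle chart whose composition with a fixed automorphism of `𝔨`
maps the ideals `W i x` to the ideals `I i`. -/
def IsAdapted (I : ι → LieIdeal 𝕜 𝔨) (W : ι → ∀ x, LieIdeal 𝕜 (L x)) : Prop :=
  ∀ x₀ : M, ∃ e : Trivialization 𝔨 (π 𝔨 L), MemTrivializationAtlas e ∧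
    ∃ (s : Set M) (a : autGroup 𝕜 𝔨), IsOpen s ∧ x₀ ∈ s ∧ s ⊆ e.baseSet ∧
      ∀ i, ∀ x ∈ s, ∀ v : L x, v ∈ W i x ↔ a.1 (e ⟨x, v⟩).2 ∈ I i

/-- If the transition cocycle of the bundle is trivial in the limit, then the decomposition of `𝔨`
extends to decompositions of the fibers. -/
theorem exists_isAdapted [FiniteDimensional 𝕜 𝔨]
    [Subsingleton (CechH1 M (QuotGroup I hk hI))] :
    ∃ W : ι → ∀ x, LieIdeal 𝕜 (L x), IsAdapted I W := by
  obtain ⟨𝔘, f, h, hh⟩ := (transitionCocycle L hk hI).exists_trivialization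
  -- Representatives may be chosen arbitrarily: they are only evaluated along the locally constant
  -- functions `h U`.
  choose a ha using QuotGroup.mk_surjective (hk := hk) (hI := hI)
  choose c hc hxc using 𝔘.covers
  let φ (U : 𝔘.sets) (x : M) (hx : x ∈ U.1) : L x ≃ₗ⁅𝕜⁆ 𝔨 :=
    (isLieTrivialization_chartOf 𝕜 (f.map U)).lieEquivAt (mem_baseSet_chartOf.mpr (f.le U hx))
  -- The relation `h_V g_VU = h_U` says that `a (h_V)` composed with the transition map and `a
  -- (h_U)` have the same class. The pulled back ideal is therefore independent of the member of the
  -- cover.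
  have key : ∀ (U V : 𝔘.sets) (x : M) (hU : x ∈ U.1) (hV : x ∈ V.1) (i : ι) (v : L x),
      (a (h V ⟨x, hV⟩)).1 (φ V x hV v) ∈ I i ↔ (a (h U ⟨x, hU⟩)).1 (φ U x hU v) ∈ I i := by
    intro U V x hU hV i v
    have e1 := hh U V x hU hV
    rw [← ha (h V ⟨x, hV⟩), ← ha (h U ⟨x, hU⟩)] at e1
    change _ * QuotGroup.mk hk hI _ = _ at e1
    rw [← map_mul, QuotGroup.mk_eq_mk] at e1
    rw [← e1 i (φ U x hU v)]
    have e2 : φ V x hV v = ((isLieTrivialization_chartOf 𝕜 (f.map U)).transition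
      (isLieTrivialization_chartOf 𝕜 (f.map V)) (mem_baseSet_chartOf.mpr (f.le U hU))
      (mem_baseSet_chartOf.mpr (f.le V hV))).1 (φ U x hU v) :=
      (IsLieTrivialization.transition_lieEquivAt _ _ _ _ v).symm
    rw [e2]
    rfl
  refine ⟨fun i x => comapOrderIso ((φ ⟨c x, hc x⟩ x (hxc x)).trans
    (autGroup.toLieEquiv (a (h ⟨c x, hc x⟩ ⟨x, hxc x⟩)))) (I i), fun x₀ => ?_⟩
  let U : 𝔘.sets := ⟨c x₀, hc x₀⟩
  have hU : x₀ ∈ U.1 := hxc x₀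
  -- Shrinking to the open set where `h U` keeps its value at `x₀` allows one fixed automorphism to
  -- serve for all points.
  refine ⟨chartOf 𝔨 L (f.map U), inferInstance,
    Subtype.val '' ((h U) ⁻¹' {h U ⟨x₀, hU⟩}), a (h U ⟨x₀, hU⟩), ?_, ?_, ?_, ?_⟩
  · exact U.1.2.isOpenMap_subtype_val _ ((h U).isLocallyConstant _)
  · exact ⟨⟨x₀, hU⟩, rfl, rfl⟩
  · rintro _ ⟨x, -, rfl⟩
    exact mem_baseSet_chartOf.mpr (f.le U x.2)
  · rintro i _ ⟨x, hx, rfl⟩ v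
    have hx' : h U x = h U ⟨x₀, hU⟩ := hx
    have := key U ⟨c x, hc x⟩ x x.2 (hxc x) i v
    rw [← hx']
    exact this

variable [NormedSpace ℝ 𝔨] [IsScalarTower ℝ 𝕜 𝔨]
  [∀ x, Module ℝ (L x)] [VectorBundle ℝ 𝔨 L] [ContMDiffVectorBundle ∞ 𝔨 L 𝓘(ℝ, V)]

theorem contMDiff_prodMap_linear [FiniteDimensional 𝕜 𝔨] (a : 𝔨 →ₗ[𝕜] 𝔨) :
    ContMDiff (𝓘(ℝ, V).prod 𝓘(ℝ, 𝔨)) (𝓘(ℝ, V).prod 𝓘(ℝ, 𝔨)) ∞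
      (Prod.map id a : M × 𝔨 → M × 𝔨) := by
  have ha : ContDiff ℝ ∞ a := ((LinearMap.toContinuousLinearMap a).restrictScalars ℝ).contDiff
  exact contMDiff_id.prodMap ha.contMDiff

omit [Finite ι] in
-- Composing the atlas chart with the constant automorphism `a` and restricting to `s` keeps it
-- smooth and fiberwise Lie, and sends `W i x` onto `I i`.
theorem IsAdapted.isSubbundle [FiniteDimensional 𝕜 𝔨] {W : ι → ∀ x, LieIdeal 𝕜 (L x)}
    (hW : IsAdapted I W) (i : ι) : IsSubbundle 𝕜 V (W i) (I i) := by
  intro x₀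
  obtain ⟨e, he, s, a, hs, hx₀, hse, hWs⟩ := hW x₀
  have hLie : IsLieTrivialization 𝕜 e := LieAlgebraBundle.isLieTrivialization e
  let A : 𝔨 ≃ₜ 𝔨 := a.1.toContinuousLinearEquiv.toHomeomorph
  let e' := (e.transFiberHomeomorph A).restrOpen s hs
  have hbase : e'.baseSet = e.baseSet ∩ s := rfl
  have happ : ∀ z, e' z = Prod.map id a.1 (e z) := fun z => rfl
  have hsymm : ∀ z, e'.toOpenPartialHomeomorph.symm z =
      e.toOpenPartialHomeomorph.symm (Prod.map id a.1.symm z) := fun z => rfl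
  refine ⟨e', ⟨hse hx₀, hx₀⟩, ⟨?_, ?_, ?_⟩, ?_, ?_, ?_⟩
  · intro x hx v w
    simp only [happ, Prod.map_snd, hLie.map_add x hx.1, map_add]
  · intro x hx c v
    simp only [happ, Prod.map_snd, hLie.map_smul x hx.1, map_smul]
  · intro x hx v w
    simp only [happ, Prod.map_snd, hLie.map_lie x hx.1]
    exact a.2 _ _
  · refine ((contMDiff_prodMap_linear (V := V) a.1.toLinearMap).comp_contMDiffOn
      (e.contMDiffOn.mono fun z hz => ?_)).congr fun z _ => happ z
    rw [e'.mem_source] at hz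
    exact e.mem_source.mpr hz.1
  · refine (e.contMDiffOn_symm.comp
      (contMDiff_prodMap_linear (V := V) a.1.symm.toLinearMap).contMDiffOn fun z hz => ?_).congr
        fun z _ => hsymm z
    rw [e'.mem_target] at hz
    exact e.mem_target.mpr hz.1
  · intro x hx v
    rw [hWs i x hx.2, happ]
    rfl

end Bundles

/-! ### Finite generation of the module of smooth sections -/

section VectorBundles

open Module Set Filter Topology

variable {V : Type*} [NormedAddCommGroup V] [NormedSpace ℝ V]
  {M : Type*} [TopologicalSpace M] [ChartedSpace V M]
  {F : Type*} [NormedAddCommGroup F] [NormedSpace ℝ F]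
  {E : M → Type*} [TopologicalSpace (TotalSpace F E)] [∀ x, AddCommGroup (E x)]
  [∀ x, Module ℝ (E x)] [∀ x, TopologicalSpace (E x)] [FiberBundle F E] [VectorBundle ℝ F E]

theorem exists_section_eventuallyEq [FiniteDimensional ℝ V] [T2Space M] [IsManifold 𝓘(ℝ, V) ∞ M]
    {n : ℕ∞} {x₀ : M} {U : Set M} (hU : U ∈ 𝓝 x₀) {s : ∀ x, E x}
    (hs : ContMDiffOn 𝓘(ℝ, V) (𝓘(ℝ, V).prod 𝓘(ℝ, F)) n (fun x => TotalSpace.mk' F x (s x)) U) :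
    ∃ t : Cₛ^n⟮𝓘(ℝ, V); F, E⟯, ∀ᶠ x in 𝓝 x₀, t x = s x := by
  obtain ⟨f, -, hf⟩ := (SmoothBumpFunction.nhds_basis_tsupport (I := 𝓘(ℝ, V)) x₀).mem_iff.mp
    (interior_mem_nhds.mpr hU)
  refine ⟨⟨fun x => f x • s x, ContMDiffOn.smul_section_of_tsupport
    ((f.contMDiff.of_le (by exact_mod_cast le_top)).contMDiffOn) isOpen_interior hf
    (hs.mono interior_subset)⟩, ?_⟩
  filter_upwards [f.eventuallyEq_one] with x hx
  change f x • s x = s x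
  rw [hx, Pi.one_apply, one_smul]

/-- Phrasing spanning through covectors turns failure to span into a point of the dual bundle, whose
dimension can be counted in coordinates. -/
theorem span_eq_top_iff_dual [FiniteDimensional ℝ F] (e : Trivialization F (π F E))
    [MemTrivializationAtlas e] {x : M} (hx : x ∈ e.baseSet) {ι : Type*} (v : ι → E x) :
    Submodule.span ℝ (range v) = ⊤ ↔
      ∀ l : F →L[ℝ] ℝ, (∀ i, l (e ⟨x, v i⟩).2 = 0) → l = 0 := by
  have happ : ∀ w : E x, e.linearEquivAt ℝ x hx w = (e ⟨x, w⟩).2 := fun w => rfl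
  constructor
  · intro h l hl
    have h1 : (⊤ : Submodule ℝ (E x)) ≤
        LinearMap.ker (l.toLinearMap ∘ₗ (e.linearEquivAt ℝ x hx).toLinearMap) := by
      rw [← h, Submodule.span_le]
      rintro _ ⟨i, rfl⟩
      exact hl i
    ext w
    have h2 := h1 (Submodule.mem_top (x := (e.linearEquivAt ℝ x hx).symm w))
    have h3 : l (e.linearEquivAt ℝ x hx ((e.linearEquivAt ℝ x hx).symm w)) = 0 := h2
    rwa [LinearEquiv.apply_symm_apply] at h3
  · intro h
    by_contra hne
    obtain ⟨f, hf0, hf⟩ := Submodule.exists_le_ker_of_lt_top _ (lt_top_iff_ne_top.mpr hne)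
    have := h (LinearMap.toContinuousLinearMap (f ∘ₗ (e.linearEquivAt ℝ x hx).symm.toLinearMap))
      fun i => by
        change f ((e.linearEquivAt ℝ x hx).symm (e ⟨x, v i⟩).2) = 0
        rw [← happ, LinearEquiv.symm_apply_apply]
        exact hf (Submodule.subset_span ⟨i, rfl⟩)
    apply hf0
    ext w
    have h3 := congrArg (fun l : F →L[ℝ] ℝ => l (e.linearEquivAt ℝ x hx w)) this
    change f ((e.linearEquivAt ℝ x hx).symm (e.linearEquivAt ℝ x hx w)) = 0 at h3
    rwa [LinearEquiv.symm_apply_apply] at h3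

variable [ContMDiffVectorBundle ∞ F E 𝓘(ℝ, V)]

theorem contMDiffOn_apply_section {n : ℕ∞} (s : Cₛ^n⟮𝓘(ℝ, V); F, E⟯) (e : Trivialization F (π F E))
    [MemTrivializationAtlas e] :
    ContMDiffOn 𝓘(ℝ, V) 𝓘(ℝ, F) n (fun x => (e ⟨x, s x⟩).2) e.baseSet := by
  have : ContMDiffVectorBundle (n : WithTop ℕ∞) F E 𝓘(ℝ, V) :=
    ContMDiffVectorBundle.of_le (n := ∞) (by exact_mod_cast le_top)
  exact (e.contMDiffOn_section_baseSet_iff (n := n)).mp s.contMDiff.contMDiffOn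

/-- `C^1` maps are locally Lipschitz and so do not raise Hausdorff dimension. This serves as an easy
form of Sard's theorem. -/
theorem dimH_image_le_of_contDiffOn {X Y : Type*} [NormedAddCommGroup X] [NormedSpace ℝ X]
    [FiniteDimensional ℝ X] [NormedAddCommGroup Y] [NormedSpace ℝ Y] {D : Set X} (hD : IsOpen D)
    {f : X → Y} (hf : ContDiffOn ℝ 1 f D) : dimH (f '' D) ≤ finrank ℝ X := by
  have := FiniteDimensional.proper ℝ X
  refine (dimH_image_le_of_locally_lipschitzOn fun x hx => ?_).trans
    ((dimH_mono (subset_univ D)).trans (Real.dimH_univ_eq_finrank X).le)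
  obtain ⟨C, t, ht, hC⟩ := ((hf x hx).contDiffAt (hD.mem_nhds hx)).exists_lipschitzOnWith
  exact ⟨C, t, mem_nhdsWithin_of_mem_nhds ht, hC⟩

/-- The number of sections needed to span the fibers of a vector bundle can be reduced, as long as
it is large with respect to the dimension of the total space. -/
theorem exists_span_eq_top_of_succ [FiniteDimensional ℝ V] [FiniteDimensional ℝ F]
    [SigmaCompactSpace M] [IsManifold 𝓘(ℝ, V) ∞ M] {m : ℕ}
    (hm : finrank ℝ V + finrank ℝ F < m) {A : Set M} (s : Fin (m + 1) → Cₛ^∞⟮𝓘(ℝ, V); F, E⟯)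
    (hs : ∀ x ∈ A, Submodule.span ℝ (range fun i => s i x) = ⊤) :
    ∃ t : Fin m → Cₛ^∞⟮𝓘(ℝ, V); F, E⟯, ∀ x ∈ A, Submodule.span ℝ (range fun i => t i x) = ⊤ := by
  let N : M → Set M := fun x₀ => (chartAt V x₀).source ∩ (trivializationAt F E x₀).baseSet
  have hN : ∀ x₀, N x₀ ∈ 𝓝 x₀ := fun x₀ => inter_mem (chart_source_mem_nhds V x₀)
    ((trivializationAt F E x₀).open_baseSet.mem_nhds
      (FiberBundle.mem_baseSet_trivializationAt F E x₀))
  obtain ⟨C, hC, hCN⟩ := countable_cover_nhds_of_sigmaCompact hN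
  let D : M → Set (V × (F →L[ℝ] ℝ)) := fun x₀ =>
    ((chartAt V x₀).target ∩ (chartAt V x₀).symm ⁻¹' (trivializationAt F E x₀).baseSet) ×ˢ univ
  -- In local coordinates on the dual bundle, `Φ` evaluates a covector on all the sections but the
  -- last.
  let Φ : M → V × (F →L[ℝ] ℝ) → Fin m → ℝ := fun x₀ p i =>
    p.2 (trivializationAt F E x₀ ⟨(chartAt V x₀).symm p.1, s i.castSucc ((chartAt V x₀).symm p.1)⟩).2
  have hD : ∀ x₀, IsOpen (D x₀) := fun x₀ =>
    ((chartAt V x₀).isOpen_inter_preimage_symm (trivializationAt F E x₀).open_baseSet).prod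
      isOpen_univ
  have hΦ : ∀ x₀, ContDiffOn ℝ 1 (Φ x₀) (D x₀) := by
    intro x₀
    refine contDiffOn_pi.mpr fun i => ?_
    have h1 : ContDiffOn ℝ 1 (fun u => (trivializationAt F E x₀ ⟨(chartAt V x₀).symm u,
        s i.castSucc ((chartAt V x₀).symm u)⟩).2)
        ((chartAt V x₀).target ∩ (chartAt V x₀).symm ⁻¹' (trivializationAt F E x₀).baseSet) := by
      rw [← contMDiffOn_iff_contDiffOn]
      have h2 : ContMDiffOn 𝓘(ℝ, V) 𝓘(ℝ, V) ∞ (chartAt V x₀).symm (chartAt V x₀).target :=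
        contMDiffOn_chart_symm
      refine ContMDiffOn.of_le (n := ∞) ?_ (by exact_mod_cast le_top)
      exact (contMDiffOn_apply_section (s i.castSucc) (trivializationAt F E x₀)).comp
        (h2.mono inter_subset_left) fun u hu => hu.2
    exact (contDiffOn_snd).clm_apply (h1.comp contDiffOn_fst fun p hp => hp.1)
  have hdim : dimH (⋃ x₀ ∈ C, Φ x₀ '' D x₀) < finrank ℝ (Fin m → ℝ) := by
    rw [dimH_bUnion hC, finrank_fin_fun]
    refine (iSup₂_le fun x₀ _ => dimH_image_le_of_contDiffOn (hD x₀) (hΦ x₀)).trans_lt ?_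
    rw [finrank_prod, ← (LinearMap.toContinuousLinearMap (𝕜 := ℝ) (E := F) (F' := ℝ)).finrank_eq,
      Subspace.dual_finrank_eq]
    exact_mod_cast hm
  -- Countably many images of dimension at most `dim V + dim F < m` miss a point `c`. Its
  -- coordinates are the multiples of the last section to subtract from the others.
  obtain ⟨c, hc⟩ := (dense_compl_of_dimH_lt_finrank hdim).nonempty
  refine ⟨fun i => s i.castSucc - c i • s (Fin.last m), fun x hx => ?_⟩
  obtain ⟨x₀, hx₀, hxN⟩ : ∃ x₀ ∈ C, x ∈ N x₀ := by
    have := hCN.symm ▸ mem_univ x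
    simpa using this
  rw [span_eq_top_iff_dual (trivializationAt F E x₀) hxN.2]
  have hsx := (span_eq_top_iff_dual (trivializationAt F E x₀) hxN.2 _).mp (hs x hx)
  intro l hl
  let ε := (trivializationAt F E x₀).linearEquivAt ℝ x hxN.2
  have hl' : ∀ i : Fin m, l (ε (s i.castSucc x)) = c i * l (ε (s (Fin.last m) x)) := by
    intro i
    have h1 : l (ε (s i.castSucc x - c i • s (Fin.last m) x)) = 0 := hl i
    rwa [map_sub, map_smul, map_sub, map_smul, smul_eq_mul, sub_eq_zero] at h1
  by_cases h0 : l (ε (s (Fin.last m) x)) = 0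
  · refine hsx l fun i => ?_
    change l (ε (s i x)) = 0
    refine Fin.lastCases h0 (fun i => ?_) i
    rw [hl', h0, mul_zero]
  -- A covector killing all the new sections but not the last old one, rescaled to take the value 1
  -- there, would be sent to `c` by `Φ`.
  · refine absurd ?_ hc
    refine mem_biUnion hx₀ ⟨((chartAt V x₀) x, (l (ε (s (Fin.last m) x)))⁻¹ • l), ?_, ?_⟩
    · refine ⟨⟨(chartAt V x₀).map_source hxN.1, ?_⟩, mem_univ _⟩
      rw [mem_preimage, (chartAt V x₀).left_inv hxN.1]
      exact hxN.2
    · funext i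
      simp only [Φ]
      rw [(chartAt V x₀).left_inv hxN.1]
      change (l (ε (s (Fin.last m) x)))⁻¹ * l (ε (s i.castSucc x)) = c i
      rw [hl' i]
      field_simp

theorem exists_span_eq_top_nhds [FiniteDimensional ℝ V] [T2Space M] [IsManifold 𝓘(ℝ, V) ∞ M]
    [FiniteDimensional ℝ F] (x₀ : M) : ∃ T : Set Cₛ^∞⟮𝓘(ℝ, V); F, E⟯, T.Finite ∧
      ∀ᶠ x in 𝓝 x₀, Submodule.span ℝ ((fun s => s x) '' T) = ⊤ := by
  let e := trivializationAt F E x₀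
  let b := finBasis ℝ F
  have he : e.baseSet ∈ 𝓝 x₀ :=
    e.open_baseSet.mem_nhds (FiberBundle.mem_baseSet_trivializationAt F E x₀)
  choose t ht using fun i => exists_section_eventuallyEq (n := ⊤) he
    (e.contMDiffOn_localFrame_baseSet (I := 𝓘(ℝ, V)) ∞ b i)
  refine ⟨range t, finite_range t, ?_⟩
  filter_upwards [eventually_all.mpr ht, he] with x hx hxe
  rw [← range_comp, eq_top_iff]
  have := (e.isLocalFrameOn_localFrame_baseSet 𝓘(ℝ, V) ∞ b).generating hxe
  refine this.trans (Submodule.span_mono ?_)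
  rintro _ ⟨i, rfl⟩
  exact ⟨i, hx i⟩

theorem exists_finite_span_eq_top [FiniteDimensional ℝ V] [T2Space M] [IsManifold 𝓘(ℝ, V) ∞ M]
    [FiniteDimensional ℝ F] {A : Set M} (hA : IsCompact A) :
    ∃ T : Set Cₛ^∞⟮𝓘(ℝ, V); F, E⟯, T.Finite ∧
      ∀ x ∈ A, Submodule.span ℝ ((fun s => s x) '' T) = ⊤ := by
  refine hA.induction_on (p := fun A => ∃ T : Set Cₛ^∞⟮𝓘(ℝ, V); F, E⟯, T.Finite ∧
      ∀ x ∈ A, Submodule.span ℝ ((fun s => s x) '' T) = ⊤) ⟨∅, finite_empty, by simp⟩ ?_ ?_ ?_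
  · rintro s t hst ⟨T, hT, h⟩
    exact ⟨T, hT, fun x hx => h x (hst hx)⟩
  · rintro s t ⟨T, hT, h⟩ ⟨T', hT', h'⟩
    refine ⟨T ∪ T', hT.union hT', ?_⟩
    rintro x (hx | hx)
    · exact top_le_iff.mp ((h x hx).symm.le.trans
        (Submodule.span_mono (image_mono subset_union_left)))
    · exact top_le_iff.mp ((h' x hx).symm.le.trans
        (Submodule.span_mono (image_mono subset_union_right)))
  · intro x _
    obtain ⟨T, hT, h⟩ := exists_span_eq_top_nhds (V := V) (F := F) (E := E) x
    exact ⟨_, mem_nhdsWithin_of_mem_nhds h, T, hT, fun y hy => hy⟩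

/-- The point is that the number of sections does not depend on the compact set, so families over
infinitely many compact sets can be glued index by index. -/
theorem exists_fin_span_eq_top [FiniteDimensional ℝ V] [T2Space M] [IsManifold 𝓘(ℝ, V) ∞ M]
    [SigmaCompactSpace M] [FiniteDimensional ℝ F] {A : Set M} (hA : IsCompact A) :
    ∃ t : Fin (finrank ℝ V + finrank ℝ F + 1) → Cₛ^∞⟮𝓘(ℝ, V); F, E⟯,
      ∀ x ∈ A, Submodule.span ℝ (range fun i => t i x) = ⊤ := by
  have key : ∀ m, (∃ t : Fin (finrank ℝ V + finrank ℝ F + 1 + m) → Cₛ^∞⟮𝓘(ℝ, V); F, E⟯,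
      ∀ x ∈ A, Submodule.span ℝ (range fun i => t i x) = ⊤) →
      ∃ t : Fin (finrank ℝ V + finrank ℝ F + 1) → Cₛ^∞⟮𝓘(ℝ, V); F, E⟯,
        ∀ x ∈ A, Submodule.span ℝ (range fun i => t i x) = ⊤ := by
    intro m
    induction m with
    | zero => exact id
    | succ m ih =>
      rintro ⟨t, ht⟩
      exact ih (exists_span_eq_top_of_succ (by omega) t ht)
  obtain ⟨T, hT, h⟩ := exists_finite_span_eq_top (V := V) (F := F) (E := E) hA
  obtain ⟨m, t, ht⟩ := hT.fin_param
  -- Padding with zero sections ensures the family is at least as large as the bound, so the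
  -- reduction can be run exactly `m` times.
  refine key m ⟨Fin.append (fun _ => 0) t, fun x hx => top_le_iff.mp ((h x hx).symm.le.trans
    (Submodule.span_mono ?_))⟩
  rintro _ ⟨s, hs, rfl⟩
  obtain ⟨i, rfl⟩ : s ∈ range t := ht.2 ▸ hs
  exact ⟨Fin.natAdd _ i, by simp⟩

/-- The module of smooth sections of a vector bundle is finitely generated. -/
theorem exists_fintype_span_eq_top [FiniteDimensional ℝ V] [T2Space M] [IsManifold 𝓘(ℝ, V) ∞ M]
    [SigmaCompactSpace M] [FiniteDimensional ℝ F] :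
    ∃ (m : ℕ) (t : Fin m × Fin 2 → Cₛ^∞⟮𝓘(ℝ, V); F, E⟯),
      ∀ x, Submodule.span ℝ (range fun i => t i x) = ⊤ := by
  have := ChartedSpace.locallyCompactSpace V M
  -- The shift makes `K 0` empty, so that the shells `A n` cover `M`, including its innermost part.
  -- Shells with distinct indices of equal parity are disjoint.
  let K := (CompactExhaustion.choice M).shiftr
  let A : ℕ → Set M := fun n => K (n + 1) \ interior (K n)
  have hAc : ∀ n, IsCompact (A n) := fun n => (K.isCompact _).diff isOpen_interior
  have hAdisj : ∀ n p x, n < p → n % 2 = p % 2 → x ∈ A n → x ∉ A p := by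
    intro n p x hnp h2 hx hxp
    exact hxp.2 (K.subset_interior (show n + 1 < p by omega) hx.1)
  have hAeq : ∀ n p x, n % 2 = p % 2 → x ∈ A n → x ∈ A p → n = p := by
    intro n p x h2 hx hxp
    rcases lt_trichotomy n p with h | h | h
    · exact absurd hxp (hAdisj n p x h h2 hx)
    · exact h
    · exact absurd hx (hAdisj p n x h h2.symm hxp)
  choose T hT using fun n => exists_fin_span_eq_top (V := V) (F := F) (E := E) (hAc n)
  -- For each parity the shells form a locally finite disjoint family, so one section can restrict
  -- to the prescribed sections on all of them. The condition on its values is affine, hence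
  -- accessible to partitions of unity.
  have hglue : ∀ i : Fin (finrank ℝ V + finrank ℝ F + 1) × Fin 2,
      ∃ S : Cₛ^∞⟮𝓘(ℝ, V); F, E⟯, ∀ x, ∀ n : ℕ, n % 2 = i.2 → x ∈ A n → S x = T n i.1 x := by
    rintro ⟨j, q⟩
    refine exists_contMDiffSection_forall_mem_convex_of_local (n := ⊤) 𝓘(ℝ, V) E
      (fun x => {v | ∀ n : ℕ, n % 2 = q → x ∈ A n → v = T n j x}) ?_ ?_
    · intro x v hv w hw a b _ _ hab n hn hx
      rw [hv n hn hx, hw n hn hx, ← add_smul, hab, one_smul]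
    · intro x₀
      obtain ⟨n₀, hn₀⟩ := K.exists_mem_nhds x₀
      -- This neighborhood meets only shells containing `x₀`: those with `n > n₀` avoid `K n₀`, and
      -- finitely many others are removed.
      have hU : K n₀ ∩ ⋂ n ∈ {n | n ≤ n₀ ∧ x₀ ∉ A n}, (A n)ᶜ ∈ 𝓝 x₀ := by
        refine inter_mem hn₀ ((biInter_mem ((finite_le_nat n₀).subset fun n hn => hn.1)).mpr
          fun n hn => (hAc n).isClosed.isOpen_compl.mem_nhds hn.2)
      have hmem : ∀ y ∈ K n₀ ∩ ⋂ n ∈ {n | n ≤ n₀ ∧ x₀ ∉ A n}, (A n)ᶜ, ∀ n, y ∈ A n → x₀ ∈ A n := by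
        intro y hy n hn
        by_contra hx₀
        have hle : n ≤ n₀ := by
          by_contra! hlt
          exact hn.2 (K.subset_interior hlt hy.1)
        exact mem_iInter₂.mp hy.2 n ⟨hle, hx₀⟩ hn
      by_cases hex : ∃ n, n % 2 = (q : ℕ) ∧ x₀ ∈ A n
      · obtain ⟨n, hn, hx₀⟩ := hex
        refine ⟨_, hU, T n j, (T n j).contMDiff.contMDiffOn, fun y hy p hp hyp => ?_⟩
        rw [hAeq n p x₀ (hn.trans hp.symm) hx₀ (hmem y hy p hyp)]
      · refine ⟨_, hU, (0 : Cₛ^∞⟮𝓘(ℝ, V); F, E⟯), (ContMDiffSection.contMDiff _).contMDiffOn,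
          fun y hy p hp hyp => absurd ⟨p, hp, hmem y hy p hyp⟩ hex⟩
  choose S hS using hglue
  refine ⟨_, S, fun x => ?_⟩
  obtain ⟨n, hn⟩ : ∃ n, x ∈ A n := by
    have h := (CompactExhaustion.choice M).mem_sdiff_shiftr_find x
    exact ⟨_, h.1, fun hi => h.2 (interior_subset hi)⟩
  refine top_le_iff.mp ((hT n x hn).symm.le.trans (Submodule.span_mono ?_))
  rintro _ ⟨j, rfl⟩
  exact ⟨(j, ⟨n % 2, Nat.mod_lt _ two_pos⟩), hS (j, ⟨n % 2, Nat.mod_lt _ two_pos⟩) x n rfl hn⟩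

end VectorBundles

/-! ### Nonvanishing loci, and coefficients with respect to spanning sections -/

section VectorBundles

open Module Set Filter Topology

variable {V : Type*} [NormedAddCommGroup V] [NormedSpace ℝ V]
  {M : Type*} [TopologicalSpace M] [ChartedSpace V M]
  {F : Type*} [NormedAddCommGroup F] [NormedSpace ℝ F]
  {E : M → Type*} [TopologicalSpace (TotalSpace F E)] [∀ x, AddCommGroup (E x)]
  [∀ x, Module ℝ (E x)] [∀ x, TopologicalSpace (E x)] [FiberBundle F E] [VectorBundle ℝ F E]
  [ContMDiffVectorBundle ∞ F E 𝓘(ℝ, V)]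

theorem isOpen_ne_zero {n : ℕ∞} (s : Cₛ^n⟮𝓘(ℝ, V); F, E⟯) : IsOpen {x | s x ≠ 0} := by
  rw [isOpen_iff_mem_nhds]
  intro x₀ hx₀
  let e := trivializationAt F E x₀
  have hmem : x₀ ∈ e.baseSet := FiberBundle.mem_baseSet_trivializationAt F E x₀
  have hzero : ∀ x (hx : x ∈ e.baseSet) (v : E x), (e ⟨x, v⟩).2 = 0 ↔ v = 0 := fun x hx v =>
    (e.linearEquivAt ℝ x hx).map_eq_zero_iff
  have hc : ContinuousAt (fun x => (e ⟨x, s x⟩).2) x₀ :=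
    (contMDiffOn_apply_section s e).continuousOn.continuousAt (e.open_baseSet.mem_nhds hmem)
  filter_upwards [hc.eventually_ne (fun h => hx₀ ((hzero x₀ hmem _).mp h)),
    e.open_baseSet.mem_nhds hmem] with x hx hxe
  exact fun h => hx ((hzero x hxe _).mpr h)

/-- Every `C^n` section is a linear combination, with `C^n` functions as coefficients, of any
finitely many `C^n` sections that span the fibers. -/
theorem exists_coefficients [FiniteDimensional ℝ V] [FiniteDimensional ℝ F] [T2Space M]
    [SigmaCompactSpace M] [IsManifold 𝓘(ℝ, V) ∞ M] {n : ℕ∞} {ι : Type*} [Fintype ι]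
    (w : ι → Cₛ^n⟮𝓘(ℝ, V); F, E⟯) (hw : ∀ x, Submodule.span ℝ (range fun i => w i x) = ⊤)
    (X : Cₛ^n⟮𝓘(ℝ, V); F, E⟯) :
    ∃ f : ι → C^n⟮𝓘(ℝ, V), M; 𝓘(ℝ, ℝ), ℝ⟯, ∀ x, X x = ∑ i, f i x • w i x := by
  have : CompleteSpace F := FiniteDimensional.complete ℝ F
  -- The admissible coefficient vectors at a point form an affine, hence convex, set, so local
  -- solutions can be averaged.
  suffices h : ∃ f : C^n⟮𝓘(ℝ, V), M; 𝓘(ℝ, ι → ℝ), ι → ℝ⟯,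
      ∀ x, f x ∈ {c : ι → ℝ | X x = ∑ i, c i • w i x} by
    obtain ⟨f, hf⟩ := h
    exact ⟨fun i => ⟨fun x => f x i, contMDiff_pi_space.mp f.contMDiff i⟩, hf⟩
  refine exists_contMDiffMap_forall_mem_convex_of_local 𝓘(ℝ, V) ?_ ?_
  · intro x c hc d hd a b _ _ hab
    simp only [mem_ofPred_eq, Pi.add_apply, Pi.smul_apply, smul_eq_mul, add_smul, mul_smul,
      Finset.sum_add_distrib, ← Finset.smul_sum] at hc hd ⊢
    rw [← hc, ← hd, ← add_smul, hab, one_smul]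
  · intro x₀
    let e := trivializationAt F E x₀
    have hx₀ : x₀ ∈ e.baseSet := FiberBundle.mem_baseSet_trivializationAt F E x₀
    let wt : M → ι → F := fun x i => (e ⟨x, w i x⟩).2
    have hwt : ContMDiffOn 𝓘(ℝ, V) 𝓘(ℝ, ι → F) n wt e.baseSet :=
      contMDiffOn_pi_space.mpr fun i => contMDiffOn_apply_section (w i) e
    let B : (ι → F) →L[ℝ] (ι → ℝ) →L[ℝ] F := ∑ i,
      (ContinuousLinearMap.smulRightL ℝ (ι → ℝ) F (ContinuousLinearMap.proj i)).comp
        (ContinuousLinearMap.proj i)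
    have hB : ∀ u c, B u c = ∑ i, c i • u i := by
      intro u c
      simp [B]
    have hsurj : Function.Surjective (B (wt x₀)) := by
      intro z
      let ε := e.linearEquivAt ℝ x₀ hx₀
      have hz : ε.symm z ∈ Submodule.span ℝ (range fun i => w i x₀) := hw x₀ ▸ Submodule.mem_top
      obtain ⟨c, hc⟩ := (Submodule.mem_span_range_iff_exists_fun ℝ).mp hz
      refine ⟨c, ?_⟩
      have h2 := congrArg ε hc
      rw [map_sum, LinearEquiv.apply_symm_apply] at h2
      simp only [map_smul] at h2
      rw [hB]
      exact h2
    -- A right inverse at `x₀` is kept fixed. Near `x₀` the composite `Q (wt x) = B (wt x) ∘ R'`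
    -- stays invertible, so `R' ∘ (Q (wt x))⁻¹` is a right inverse of `B (wt x)` depending on `x` in
    -- a `C^n` way.
    obtain ⟨R, hR⟩ := (B (wt x₀)).toLinearMap.exists_rightInverse_of_surjective
      (LinearMap.range_eq_top.mpr hsurj)
    let R' : F →L[ℝ] (ι → ℝ) := LinearMap.toContinuousLinearMap R
    let Q : (ι → F) →L[ℝ] (F →L[ℝ] F) :=
      ((ContinuousLinearMap.compL ℝ F (ι → ℝ) F).flip R').comp B
    have hQ : ∀ u z, Q u z = B u (R' z) := fun u z => rfl
    let O : Set (ι → F) := Q ⁻¹' range ((↑) : (F ≃L[ℝ] F) → F →L[ℝ] F)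
    have hO : IsOpen O := ContinuousLinearEquiv.isOpen.preimage Q.continuous
    have hx₀O : wt x₀ ∈ O := by
      refine ⟨ContinuousLinearEquiv.refl ℝ F, ?_⟩
      ext z
      exact (LinearMap.congr_fun hR z).symm
    let U : Set M := e.baseSet ∩ wt ⁻¹' O
    have hU : U ∈ 𝓝 x₀ := inter_mem (e.open_baseSet.mem_nhds hx₀)
      ((hwt.continuousOn.continuousAt (e.open_baseSet.mem_nhds hx₀)).preimage_mem_nhds
        (hO.mem_nhds hx₀O))
    refine ⟨U, hU, fun x => R' (ContinuousLinearMap.inverse (Q (wt x)) (e ⟨x, X x⟩).2), ?_, ?_⟩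
    · have hΨ : ContDiffOn ℝ n (fun p : ι → F => ContinuousLinearMap.inverse (Q p)) O := by
        rintro p ⟨ε, hε⟩
        have h1 : ContDiffAt ℝ n ContinuousLinearMap.inverse (Q p) :=
          hε ▸ contDiffAt_map_inverse ε
        exact (h1.comp p Q.contDiff.contDiffAt).contDiffWithinAt
      have h2 : ContMDiffOn 𝓘(ℝ, V) 𝓘(ℝ, F →L[ℝ] F) n
          (fun x => ContinuousLinearMap.inverse (Q (wt x))) U :=
        hΨ.contMDiffOn.comp (hwt.mono inter_subset_left) fun x hx => hx.2
      exact R'.contDiff.contMDiff.comp_contMDiffOn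
        (h2.clm_apply ((contMDiffOn_apply_section X e).mono inter_subset_left))
    · intro x hx
      obtain ⟨δ, hδ⟩ := hx.2
      let ε := e.linearEquivAt ℝ x hx.1
      apply ε.injective
      rw [map_sum]
      simp only [map_smul]
      change (e ⟨x, X x⟩).2 = ∑ i, R' (ContinuousLinearMap.inverse (Q (wt x)) (e ⟨x, X x⟩).2) i • wt x i
      rw [← hB, ← hQ, ← hδ, ContinuousLinearMap.inverse_equiv]
      exact (δ.apply_symm_apply _).symm

end VectorBundles

/-! ### The section algebra: evaluation, perfectness, centerfreeness, locality -/

section Sections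

open Module Set Filter Topology

variable {𝕜 : Type*} [RCLike 𝕜]
  {V : Type*} [NormedAddCommGroup V] [NormedSpace ℝ V]
  {M : Type*} [TopologicalSpace M] [ChartedSpace V M]
  {𝔨 : Type*} [NormedLieRing 𝔨] [NormedLieAlgebra 𝕜 𝔨] [FiniteDimensional 𝕜 𝔨]
  [NormedSpace ℝ 𝔨] [IsScalarTower ℝ 𝕜 𝔨]
  {L : M → Type*} [∀ x, LieRing (L x)] [∀ x, LieAlgebra 𝕜 (L x)]
  [∀ x, Module ℝ (L x)]
  [TopologicalSpace (TotalSpace 𝔨 L)] [∀ x, TopologicalSpace (L x)]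
  [FiberBundle 𝔨 L] [VectorBundle ℝ 𝔨 L]
  [LieAlgebraBundle 𝕜 𝔨 L] {k : ℕ∞}

theorem real_smul_lie {𝔤 : Type*} [LieRing 𝔤] [LieAlgebra 𝕜 𝔤] [Module ℝ 𝔤] [IsScalarTower ℝ 𝕜 𝔤]
    (r : ℝ) (u v : 𝔤) : ⁅r • u, v⁆ = r • ⁅u, v⁆ := by
  rw [← algebraMap_smul 𝕜 r u, smul_lie, algebraMap_smul]

theorem lie_real_smul {𝔤 : Type*} [LieRing 𝔤] [LieAlgebra 𝕜 𝔤] [Module ℝ 𝔤] [IsScalarTower ℝ 𝕜 𝔤]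
    (r : ℝ) (u v : 𝔤) : ⁅u, r • v⁆ = r • ⁅u, v⁆ := by
  rw [← algebraMap_smul 𝕜 r v, lie_smul, algebraMap_smul]

variable (𝕜) in
/-- A `C^k` section of the vector bundle as an element of `Γ^k(L)`. -/
noncomputable def ofSection (s : Cₛ^k⟮𝓘(ℝ, V); 𝔨, L⟯) : sections 𝕜 V 𝔨 L k := ⟨s, s.contMDiff⟩

/-- An element of `Γ^k(L)` as a `C^k` section of the vector bundle. -/
noncomputable def toSection (X : sections 𝕜 V 𝔨 L k) : Cₛ^k⟮𝓘(ℝ, V); 𝔨, L⟯ := ⟨X.1, X.2⟩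

/-- Multiplication of sections by a `C^k` function. -/
noncomputable def mulSection (f : C^k⟮𝓘(ℝ, V), M; 𝓘(ℝ, ℝ), ℝ⟯) :
    sections 𝕜 V 𝔨 L k →+ sections 𝕜 V 𝔨 L k where
  toFun X := ⟨fun x => f x • X.1 x, f.contMDiff.smul_section X.2⟩
  map_zero' := Subtype.ext (funext fun x => smul_zero (f x))
  map_add' X Y := Subtype.ext (funext fun x => smul_add (f x) (X.1 x) (Y.1 x))

theorem mulSection_apply (f : C^k⟮𝓘(ℝ, V), M; 𝓘(ℝ, ℝ), ℝ⟯) (X : sections 𝕜 V 𝔨 L k) (x : M) :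
    (mulSection f X).1 x = f x • X.1 x := rfl

theorem mulSection_lie [∀ x, IsScalarTower ℝ 𝕜 (L x)] (f : C^k⟮𝓘(ℝ, V), M; 𝓘(ℝ, ℝ), ℝ⟯)
    (X Y : sections 𝕜 V 𝔨 L k) : mulSection f ⁅X, Y⁆ = ⁅X, mulSection f Y⁆ :=
  Subtype.ext (funext fun x => (lie_real_smul (𝕜 := 𝕜) (f x) (X.1 x) (Y.1 x)).symm)

theorem mulSection_lie_left [∀ x, IsScalarTower ℝ 𝕜 (L x)] (f : C^k⟮𝓘(ℝ, V), M; 𝓘(ℝ, ℝ), ℝ⟯)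
    (X Y : sections 𝕜 V 𝔨 L k) : mulSection f ⁅X, Y⁆ = ⁅mulSection f X, Y⁆ :=
  Subtype.ext (funext fun x => (real_smul_lie (𝕜 := 𝕜) (f x) (X.1 x) (Y.1 x)).symm)

/-- Evaluation of sections at a point. -/
def evalSection (x : M) : sections 𝕜 V 𝔨 L k →ₗ⁅𝕜⁆ L x where
  toFun X := X.1 x
  map_add' _ _ := rfl
  map_smul' _ _ := rfl
  map_lie' := rfl

omit [∀ x, Module ℝ (L x)] [VectorBundle ℝ 𝔨 L] in
theorem evalSection_apply (x : M) (X : sections 𝕜 V 𝔨 L k) : evalSection x X = X.1 x := rfl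

variable [ContMDiffVectorBundle ∞ 𝔨 L 𝓘(ℝ, V)]

variable [FiniteDimensional ℝ V] [T2Space M] [IsManifold 𝓘(ℝ, V) ∞ M]

theorem exists_apply_eq (x₀ : M) (v : L x₀) : ∃ X : sections 𝕜 V 𝔨 L k, X.1 x₀ = v := by
  have : ContMDiffVectorBundle (k : WithTop ℕ∞) 𝔨 L 𝓘(ℝ, V) :=
    ContMDiffVectorBundle.of_le (n := ∞) (by exact_mod_cast le_top)
  let e := trivializationAt 𝔨 L x₀
  have hmem : x₀ ∈ e.baseSet := FiberBundle.mem_baseSet_trivializationAt 𝔨 L x₀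
  obtain ⟨t, ht⟩ := exists_section_eventuallyEq (n := k) (e.open_baseSet.mem_nhds hmem)
    (s := fun x => e.symm x (e ⟨x₀, v⟩).2) ((e.contMDiffOn_section_baseSet_iff (IB := 𝓘(ℝ, V))).mpr
      ((contMDiffOn_const (c := (e ⟨x₀, v⟩).2)).congr fun x hx => by rw [e.apply_mk_symm hx]))
  exact ⟨ofSection 𝕜 t, ht.self_of_nhds.trans (e.symm_apply_apply_mk hmem v)⟩

/-- Every vector of a fiber extends to a section, so the values of a central section are central in
the fibers. -/
theorem isCenterfree_sections (hk : IsCenterfree 𝕜 𝔨) :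
    IsCenterfree 𝕜 (sections 𝕜 V 𝔨 L k) := by
  rw [IsCenterfree, LieSubmodule.eq_bot_iff]
  intro X hX
  rw [LieModule.mem_maxTrivSubmodule] at hX
  refine Subtype.ext (funext fun x => ?_)
  have hx := FiberBundle.mem_baseSet_trivializationAt 𝔨 L x
  have hc : IsCenterfree 𝕜 (L x) :=
    hk.of_equiv ((isLieTrivialization_trivializationAt 𝕜 𝔨 L x).lieEquivAt hx).symm
  have : X.1 x ∈ LieAlgebra.center 𝕜 (L x) := by
    rw [LieModule.mem_maxTrivSubmodule]
    intro v
    obtain ⟨Y, rfl⟩ := exists_apply_eq (𝕜 := 𝕜) (V := V) (𝔨 := 𝔨) (k := k) x v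
    exact congrFun (congrArg Subtype.val (hX Y)) x
  rwa [show LieAlgebra.center 𝕜 (L x) = ⊥ from hc, LieSubmodule.mem_bot] at this

/-- Brackets of generators of a perfect Lie algebra span it. -/
theorem span_lie_eq_top {𝔤 : Type*} [LieRing 𝔤] [LieAlgebra 𝕜 𝔤] [Module ℝ 𝔤]
    [IsScalarTower ℝ 𝕜 𝔤] (hp : IsPerfect 𝕜 𝔤) {ι : Type*} (t : ι → 𝔤)
    (ht : Submodule.span ℝ (range t) = ⊤) :
    Submodule.span ℝ (range fun p : ι × ι => ⁅t p.1, t p.2⁆) = ⊤ := by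
  set S := Submodule.span ℝ (range fun p : ι × ι => ⁅t p.1, t p.2⁆) with hS
  have h1 : ∀ i, ∀ v : 𝔤, ⁅t i, v⁆ ∈ S := by
    intro i v
    have hv : v ∈ Submodule.span ℝ (range t) := ht ▸ Submodule.mem_top
    induction hv using Submodule.span_induction with
    | mem v hv =>
      obtain ⟨j, rfl⟩ := hv
      exact Submodule.subset_span ⟨(i, j), rfl⟩
    | zero => rw [lie_zero]; exact zero_mem S
    | add v w _ _ h h' => rw [lie_add]; exact add_mem h h'
    | smul r v _ h => rw [lie_real_smul (𝕜 := 𝕜)]; exact S.smul_mem r h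
  have h2 : ∀ u v : 𝔤, ⁅u, v⁆ ∈ S := by
    intro u v
    have hu : u ∈ Submodule.span ℝ (range t) := ht ▸ Submodule.mem_top
    induction hu using Submodule.span_induction with
    | mem u hu =>
      obtain ⟨i, rfl⟩ := hu
      exact h1 i v
    | zero => rw [zero_lie]; exact zero_mem S
    | add v w _ _ h h' => rw [add_lie]; exact add_mem h h'
    | smul r v _ h => rw [real_smul_lie (𝕜 := 𝕜)]; exact S.smul_mem r h
  rw [eq_top_iff]
  rintro x -
  have hx : x ∈ ⁅(⊤ : LieIdeal 𝕜 𝔤), (⊤ : LieIdeal 𝕜 𝔤)⁆ := by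
    rw [show ⁅(⊤ : LieIdeal 𝕜 𝔤), (⊤ : LieIdeal 𝕜 𝔤)⁆ = ⊤ from hp]
    exact LieSubmodule.mem_top x
  rw [← LieSubmodule.mem_toSubmodule, LieSubmodule.lieIdeal_oper_eq_linear_span'] at hx
  induction hx using Submodule.closure_induction with
  | zero => exact zero_mem S
  | add x y _ _ h h' => exact add_mem h h'
  | smul_mem c x h =>
    obtain ⟨a, -, b, -, rfl⟩ := h
    rw [← smul_lie]
    exact h2 _ _

variable [∀ x, IsScalarTower ℝ 𝕜 (L x)] [SigmaCompactSpace M]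

/-- Brackets of finitely many generating sections span every fiber, so a section is a finite
combination of them with function coefficients. Each coefficient moves into the first slot of its
bracket. -/
theorem isPerfect_sections (hk : IsPerfect 𝕜 𝔨) : IsPerfect 𝕜 (sections 𝕜 V 𝔨 L k) := by
  have : FiniteDimensional ℝ 𝔨 := FiniteDimensional.trans ℝ 𝕜 𝔨
  obtain ⟨m, t, ht⟩ := exists_fintype_span_eq_top (V := V) (F := 𝔨) (E := L)
  let T : Fin m × Fin 2 → sections 𝕜 V 𝔨 L k := fun i =>
    ⟨t i, (t i).contMDiff.of_le (by exact_mod_cast le_top)⟩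
  have hspan : ∀ x, Submodule.span ℝ
      (range fun p : (Fin m × Fin 2) × (Fin m × Fin 2) => toSection ⁅T p.1, T p.2⁆ x) = ⊤ := by
    intro x
    have hx := FiberBundle.mem_baseSet_trivializationAt 𝔨 L x
    have hp : IsPerfect 𝕜 (L x) :=
      hk.of_equiv ((isLieTrivialization_trivializationAt 𝕜 𝔨 L x).lieEquivAt hx).symm
    exact span_lie_eq_top hp (fun i => t i x) (ht x)
  rw [IsPerfect, eq_top_iff]
  rintro X -
  obtain ⟨f, hf⟩ := exists_coefficients _ hspan (toSection X)
  have hX : X = ∑ p, ⁅mulSection (f p) (T p.1), T p.2⁆ := by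
    refine Subtype.ext (funext fun x => ?_)
    rw [← evalSection_apply, ← evalSection_apply, map_sum]
    refine (hf x).trans (Finset.sum_congr rfl fun p _ => ?_)
    rw [← mulSection_lie_left]
    rfl
  rw [hX]
  exact sum_mem fun p _ => LieSubmodule.lie_mem_lie (LieSubmodule.mem_top _) (LieSubmodule.mem_top _)

theorem isPerfect_or_isCenterfree_sections (hk : IsPerfect 𝕜 𝔨 ∨ IsCenterfree 𝕜 𝔨) :
    IsPerfect 𝕜 (sections 𝕜 V 𝔨 L k) ∨ IsCenterfree 𝕜 (sections 𝕜 V 𝔨 L k) :=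
  hk.imp isPerfect_sections isCenterfree_sections

omit [SigmaCompactSpace M] [∀ x, IsScalarTower ℝ 𝕜 (L x)] in
/-- A map of sections that commutes with the multiplication by functions is defined fiberwise. -/
theorem apply_eq_zero_of_commute (T : sections 𝕜 V 𝔨 L k →+ sections 𝕜 V 𝔨 L k)
    (hT : ∀ (f : C^k⟮𝓘(ℝ, V), M; 𝓘(ℝ, ℝ), ℝ⟯) X, T (mulSection f X) = mulSection f (T X))
    {X : sections 𝕜 V 𝔨 L k} {x₀ : M} (hX : X.1 x₀ = 0) : (T X).1 x₀ = 0 := by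
  have : FiniteDimensional ℝ 𝔨 := FiniteDimensional.trans ℝ 𝕜 𝔨
  have : ContMDiffVectorBundle (k : WithTop ℕ∞) 𝔨 L 𝓘(ℝ, V) :=
    ContMDiffVectorBundle.of_le (n := ∞) (by exact_mod_cast le_top)
  let e := trivializationAt 𝔨 L x₀
  have hmem : x₀ ∈ e.baseSet := FiberBundle.mem_baseSet_trivializationAt 𝔨 L x₀
  let b := finBasis ℝ 𝔨
  obtain ⟨χ, -, hχ⟩ := (SmoothBumpFunction.nhds_basis_tsupport (I := 𝓘(ℝ, V)) x₀).mem_iff.mp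
    (e.open_baseSet.mem_nhds hmem)
  have hχk : ContMDiff 𝓘(ℝ, V) 𝓘(ℝ, ℝ) k χ := χ.contMDiff.of_le (by exact_mod_cast le_top)
  have hχ1 : χ x₀ = 1 := χ.eventuallyEq_one.self_of_nhds
  let c : Fin (finrank ℝ 𝔨) → M → ℝ := fun i x => χ x * b.repr (e ⟨x, X.1 x⟩).2 i
  have hc : ∀ i, ContMDiff 𝓘(ℝ, V) 𝓘(ℝ, ℝ) k (c i) := by
    intro i
    have h1 : ContMDiffOn 𝓘(ℝ, V) 𝓘(ℝ, ℝ) k (fun x => b.repr (e ⟨x, X.1 x⟩).2 i) e.baseSet :=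
      (LinearMap.toContinuousLinearMap (b.coord i)).contDiff.contMDiff.comp_contMDiffOn
        (contMDiffOn_apply_section (toSection X) e)
    refine contMDiff_of_tsupport fun x hx => ?_
    have hx' : x ∈ e.baseSet := hχ (tsupport_mul_subset_left hx)
    exact hχk.contMDiffAt.mul (h1.contMDiffAt (e.open_baseSet.mem_nhds hx'))
  let Y : Fin (finrank ℝ 𝔨) → sections 𝕜 V 𝔨 L k := fun i =>
    ⟨fun x => χ x • e.localFrame b i x, ContMDiffOn.smul_section_of_tsupport hχk.contMDiffOn
      e.open_baseSet hχ (e.contMDiffOn_localFrame_baseSet (I := 𝓘(ℝ, V)) k b i)⟩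
  let f : C^k⟮𝓘(ℝ, V), M; 𝓘(ℝ, ℝ), ℝ⟯ := ⟨fun x => 1 - χ x * χ x,
    contMDiff_const.sub (hχk.mul hχk)⟩
  let g : Fin (finrank ℝ 𝔨) → C^k⟮𝓘(ℝ, V), M; 𝓘(ℝ, ℝ), ℝ⟯ := fun i => ⟨c i, hc i⟩
  -- With `χ` a bump function and `b_i` the coordinates in a local frame `e_i`, this reads `X = ∑ (χ
  -- b_i(X)) (χ e_i) + (1 - χ²) X`. All the coefficient functions vanish at `x₀` when `X` does, and
  -- `T` pulls them out.
  have hXeq : X = ∑ i, mulSection (g i) (Y i) + mulSection f X := by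
    refine Subtype.ext (funext fun x => ?_)
    rw [← evalSection_apply, ← evalSection_apply, map_add, map_sum]
    simp only [evalSection_apply, mulSection_apply]
    change X.1 x = ∑ i, (χ x * b.repr (e ⟨x, X.1 x⟩).2 i) • χ x • e.localFrame b i x +
      (1 - χ x * χ x) • X.1 x
    by_cases hx : x ∈ e.baseSet
    · have h2 : ∑ i, b.repr (e ⟨x, X.1 x⟩).2 i • e.localFrame b i x = X.1 x := by
        apply (e.linearEquivAt ℝ x hx).injective
        rw [map_sum]
        simp only [map_smul, e.localFrame_apply_of_mem_baseSet b hx, Trivialization.basisAt,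
          Basis.map_apply, LinearEquiv.apply_symm_apply]
        exact b.sum_repr _
      have h3 : ∀ i, (χ x * b.repr (e ⟨x, X.1 x⟩).2 i) • χ x • e.localFrame b i x =
          (χ x * χ x) • b.repr (e ⟨x, X.1 x⟩).2 i • e.localFrame b i x := by
        intro i
        rw [smul_smul, smul_smul]
        congr 1
        ring
      rw [Finset.sum_congr rfl fun i _ => h3 i, ← Finset.smul_sum, h2, ← add_smul]
      simp
    · have h0 : χ x = 0 := image_eq_zero_of_notMem_tsupport fun h => hx (hχ h)
      simp [h0]
  rw [hXeq, map_add, map_sum, ← evalSection_apply, map_add, map_sum]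
  simp only [hT, evalSection_apply, mulSection_apply]
  have hc0 : ∀ i, c i x₀ = 0 := by
    intro i
    have : (e ⟨x₀, X.1 x₀⟩).2 = 0 := by
      rw [hX]
      exact (e.linearEquivAt ℝ x₀ hmem).map_zero
    simp [c, this]
  have hf0 : f x₀ = 0 := by
    change 1 - χ x₀ * χ x₀ = 0
    rw [hχ1]; ring
  have hg0 : ∀ i, g i x₀ = 0 := hc0
  simp only [hg0, hf0, zero_smul, Finset.sum_const_zero, add_zero]

end Sections

/-! ### Decomposing the section algebra -/

section Decomposition

open Module Set Filter Topology

variable {𝕜 : Type*} [RCLike 𝕜]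
  {V : Type*} [NormedAddCommGroup V] [NormedSpace ℝ V]
  {M : Type*} [TopologicalSpace M] [ChartedSpace V M]
  {𝔨 : Type*} [NormedLieRing 𝔨] [NormedLieAlgebra 𝕜 𝔨] [FiniteDimensional 𝕜 𝔨]
  [NormedSpace ℝ 𝔨] [IsScalarTower ℝ 𝕜 𝔨]
  {L : M → Type*} [∀ x, LieRing (L x)] [∀ x, LieAlgebra 𝕜 (L x)]
  [∀ x, Module ℝ (L x)]
  [TopologicalSpace (TotalSpace 𝔨 L)] [∀ x, TopologicalSpace (L x)]
  [FiberBundle 𝔨 L] [VectorBundle ℝ 𝔨 L]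
  [LieAlgebraBundle 𝕜 𝔨 L] {k : ℕ∞} {ι : Type*}

omit [FiniteDimensional 𝕜 𝔨] [NormedSpace ℝ 𝔨] [IsScalarTower ℝ 𝕜 𝔨] [∀ x, Module ℝ (L x)]
  [VectorBundle ℝ 𝔨 L] in
theorem IsAdapted.isIndecDecomp {I : ι → LieIdeal 𝕜 𝔨} {W : ι → ∀ x, LieIdeal 𝕜 (L x)}
    (hW : IsAdapted I W) (hI : IsIndecDecomp 𝕜 I) (x : M) : IsIndecDecomp 𝕜 fun i => W i x := by
  obtain ⟨e, he, s, a, -, hx, hse, hWs⟩ := hW x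
  have hLie : IsLieTrivialization 𝕜 e := LieAlgebraBundle.isLieTrivialization e
  exact hI.of_equiv ((hLie.lieEquivAt (hse hx)).trans (autGroup.toLieEquiv a))
    fun i v => hWs i x hx v

variable [ContMDiffVectorBundle ∞ 𝔨 L 𝓘(ℝ, V)]

/-- The fiberwise projection of a `C^k` section to a summand is `C^k`. -/
theorem IsAdapted.contMDiff_projection [Fintype ι] {I : ι → LieIdeal 𝕜 𝔨}
    {W : ι → ∀ x, LieIdeal 𝕜 (L x)}
    (hW : IsAdapted I W) (hI : IsIndecDecomp 𝕜 I) (i : ι) {q : ∀ x, L x →ₗ[𝕜] L x}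
    (hq : ∀ x, ∀ v ∈ W i x, q x v = v) (hq' : ∀ x j, j ≠ i → ∀ v ∈ W j x, q x v = 0)
    (X : sections 𝕜 V 𝔨 L k) :
    ContMDiff 𝓘(ℝ, V) (𝓘(ℝ, V).prod 𝓘(ℝ, 𝔨)) k fun x => TotalSpace.mk' 𝔨 x (q x (X.1 x)) := by
  have : ContMDiffVectorBundle (k : WithTop ℕ∞) 𝔨 L 𝓘(ℝ, V) :=
    ContMDiffVectorBundle.of_le (n := ∞) (by exact_mod_cast le_top)
  obtain ⟨p, -, hp, hp', -⟩ := hI.exists_projections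
  intro x₀
  obtain ⟨e, he, s, a, hs, hx₀, hse, hWs⟩ := hW x₀
  have hLie : IsLieTrivialization 𝕜 e := LieAlgebraBundle.isLieTrivialization e
  -- In the adapted chart the fiberwise projection is this constant linear map.
  let A : 𝔨 →L[ℝ] 𝔨 := (LinearMap.toContinuousLinearMap
    (a.1.symm.toLinearMap ∘ₗ p i ∘ₗ a.1.toLinearMap)).restrictScalars ℝ
  rw [e.contMDiffAt_section_iff (hse hx₀)]
  have h1 : ContMDiffAt 𝓘(ℝ, V) 𝓘(ℝ, 𝔨) k (fun x => A (e ⟨x, X.1 x⟩).2) x₀ :=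
    A.contDiff.contMDiff.contMDiffAt.comp x₀
      ((contMDiffOn_apply_section (toSection X) e).contMDiffAt (e.open_baseSet.mem_nhds (hse hx₀)))
  refine h1.congr_of_eventuallyEq ?_
  filter_upwards [hs.mem_nhds hx₀] with x hx
  have h2 := (hW.isIndecDecomp hI x).apply_projection
    ((hLie.lieEquivAt (hse hx)).trans (autGroup.toLieEquiv a)) (fun i v => hWs i x hx v) i
    (hq x) (hq' x) (hp i) (hp' i) (X.1 x)
  exact (LinearEquiv.eq_symm_apply a.1).mpr h2

/-- The values at a point of the elements of an ideal of `Γ^k(L)`. -/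
def fiberIdeal [FiniteDimensional ℝ V] [T2Space M] [IsManifold 𝓘(ℝ, V) ∞ M]
    (P : LieIdeal 𝕜 (sections 𝕜 V 𝔨 L k)) (x : M) : LieIdeal 𝕜 (L x) where
  __ := P.toSubmodule.map (evalSection (𝕜 := 𝕜) (V := V) (𝔨 := 𝔨) (k := k) x).toLinearMap
  lie_mem {v w} hw := by
    obtain ⟨X, hX, rfl⟩ := hw
    obtain ⟨Y, rfl⟩ := exists_apply_eq (𝕜 := 𝕜) (V := V) (𝔨 := 𝔨) (k := k) x v
    exact ⟨⁅Y, X⁆, lie_mem_right 𝕜 _ P _ _ hX, rfl⟩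

variable [FiniteDimensional ℝ V] [T2Space M] [IsManifold 𝓘(ℝ, V) ∞ M]

/-- Decompositions of `Γ^k(L)` into two ideals come from decompositions of the fibers. -/
theorem isCompl_fiberIdeal [∀ x, IsScalarTower ℝ 𝕜 (L x)] [SigmaCompactSpace M]
    (hk : IsPerfect 𝕜 𝔨 ∨ IsCenterfree 𝕜 𝔨) {P Q : LieIdeal 𝕜 (sections 𝕜 V 𝔨 L k)}
    (h : IsCompl P Q) (x : M) : IsCompl (fiberIdeal P x) (fiberIdeal Q x) := by
  refine ⟨disjoint_iff.mpr ?_, codisjoint_iff.mpr ?_⟩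
  · rw [LieSubmodule.eq_bot_iff]
    rintro _ ⟨⟨X, hX, rfl⟩, ⟨Y, hY, hXY⟩⟩
    -- If `X ∈ P` and `Y ∈ Q` agree at `x`, then `X - Y` vanishes there. Since `p` is linear over
    -- functions, `p (X - Y) = X` vanishes there too.
    obtain ⟨p, hp, hpP, hpQ, -⟩ := exists_projection h
    have hcomm : ∀ (f : C^k⟮𝓘(ℝ, V), M; 𝓘(ℝ, ℝ), ℝ⟯) X,
        p.toAddMonoidHom (mulSection f X) = mulSection f (p.toAddMonoidHom X) := fun f X =>
      centroid_commute (isPerfect_or_isCenterfree_sections hk) p.toAddMonoidHom (mulSection f) hp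
        (mulSection_lie f) X
    have h0 : (X - Y).1 x = 0 := sub_eq_zero.mpr hXY.symm
    have h1 := apply_eq_zero_of_commute p.toAddMonoidHom hcomm h0
    have h2 : p (X - Y) = X := by rw [map_sub, hpP X hX, hpQ Y hY, sub_zero]
    have h3 : (p (X - Y)).1 x = 0 := h1
    rw [h2] at h3
    exact h3
  · rw [eq_top_iff]
    rintro v -
    obtain ⟨X, rfl⟩ := exists_apply_eq (𝕜 := 𝕜) (V := V) (𝔨 := 𝔨) (k := k) x v
    obtain ⟨Y, hY, Z, hZ, rfl⟩ := exists_add_of_isCompl h X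
    exact (LieSubmodule.mem_sup _ _ _).mpr ⟨Y.1 x, ⟨Y, hY, rfl⟩, Z.1 x, ⟨Z, hZ, rfl⟩, rfl⟩

omit [FiniteDimensional ℝ V] [T2Space M] [IsManifold 𝓘(ℝ, V) ∞ M] in
theorem IsAdapted.exists_section_projections [Fintype ι] {I : ι → LieIdeal 𝕜 𝔨}
    {W : ι → ∀ x, LieIdeal 𝕜 (L x)} (hW : IsAdapted I W) (hI : IsIndecDecomp 𝕜 I) (i : ι)
    (X : sections 𝕜 V 𝔨 L k) : ∃ Y : ι → sections 𝕜 V 𝔨 L k,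
      (∀ i, Y i ∈ sectionsIn 𝕜 V 𝔨 k (W i)) ∧ ∑ i, Y i = X ∧
        ∀ x, X.1 x ∈ W i x → (Y i).1 x = X.1 x := by
  choose q hqW hq hq' hqs using fun x => (hW.isIndecDecomp hI x).exists_projections
  refine ⟨fun i => ⟨fun x => q x i (X.1 x), hW.contMDiff_projection hI i (fun x => hq x i)
    (fun x => hq' x i) X⟩, fun i x => hqW x i _, ?_, fun x => hq x i _⟩
  refine Subtype.ext (funext fun x => ?_)
  rw [← evalSection_apply, map_sum]
  exact hqs x _

omit [∀ x, Module ℝ (L x)] [VectorBundle ℝ 𝔨 L] [ContMDiffVectorBundle ∞ 𝔨 L 𝓘(ℝ, V)]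
  [FiniteDimensional ℝ V] [T2Space M] [IsManifold 𝓘(ℝ, V) ∞ M] in
theorem iSupIndep_sectionsIn {W : ι → ∀ x, LieIdeal 𝕜 (L x)}
    (hW : ∀ x, iSupIndep fun i => W i x) : iSupIndep fun i => sectionsIn 𝕜 V 𝔨 k (W i) := by
  intro i
  have hle : ⨆ (j) (_ : j ≠ i), sectionsIn 𝕜 V 𝔨 k (W j) ≤
      sectionsIn 𝕜 V 𝔨 k fun x => ⨆ (j) (_ : j ≠ i), W j x := by
    refine iSup₂_le fun j hj X hX x => ?_
    exact le_iSup₂ (f := fun (j : ι) (_ : j ≠ i) => W j x) j hj (hX x)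
  refine Disjoint.mono_right hle (disjoint_iff.mpr ((LieSubmodule.eq_bot_iff _).mpr ?_))
  rintro X ⟨hX, hX'⟩
  refine Subtype.ext (funext fun x => ?_)
  have : X.1 x ∈ W i x ⊓ ⨆ (j) (_ : j ≠ i), W j x := ⟨hX x, hX' x⟩
  rwa [(hW x i).eq_bot, LieSubmodule.mem_bot] at this

variable [∀ x, IsScalarTower ℝ 𝕜 (L x)] [SigmaCompactSpace M] [ConnectedSpace M]

/-- The nonvanishing loci of the two pieces of a splitting are open and complementary, so
connectedness makes one of them empty and the other piece everything. -/
theorem IsAdapted.isIndecomposable_sectionsIn [Fintype ι] {I : ι → LieIdeal 𝕜 𝔨}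
    {W : ι → ∀ x, LieIdeal 𝕜 (L x)} (hk : IsPerfect 𝕜 𝔨 ∨ IsCenterfree 𝕜 𝔨)
    (hW : IsAdapted I W) (hI : IsIndecDecomp 𝕜 I) {i : ι} {D : LieIdeal 𝕜 (sections 𝕜 V 𝔨 L k)}
    (h : IsCompl (sectionsIn 𝕜 V 𝔨 k (W i)) D) :
    IsIndecomposable 𝕜 (sectionsIn 𝕜 V 𝔨 k (W i)) := by
  rintro ⟨A, B, hA, hB, hAB⟩
  have hdecomp := hW.isIndecDecomp hI
  have hPQ := isCompl_liftIdeal h hAB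
  have hfib := isCompl_fiberIdeal hk hPQ
  have hWx : ∀ x, W i x ≤ fiberIdeal (liftIdeal h A) x ∨
      W i x ≤ fiberIdeal (liftIdeal h B ⊔ D) x := by
    intro x
    have hx := FiberBundle.mem_baseSet_trivializationAt 𝔨 L x
    exact le_or_le_of_isCompl (isPerfect_or_isCenterfree_of_equiv
      ((isLieTrivialization_trivializationAt 𝕜 𝔨 L x).lieEquivAt hx).symm hk) (hfib x)
      ((hdecomp x).isCompl i) ((hdecomp x).indecomposable i)
  let O : LieIdeal 𝕜 (sectionsIn 𝕜 V 𝔨 k (W i)) → Set M := fun C => ⋃ X ∈ C, {x | X.1.1 x ≠ 0}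
  have hOopen : ∀ C, IsOpen (O C) := fun C =>
    isOpen_biUnion fun X _ => isOpen_ne_zero (toSection X.1)
  have hObot : ∀ C, O C = ∅ → C = ⊥ := by
    intro C hC
    rw [LieSubmodule.eq_bot_iff]
    intro X hX
    refine Subtype.ext (Subtype.ext (funext fun x => ?_))
    by_contra hne
    exact (hC ▸ mem_biUnion (t := fun X => {x | X.1.1 x ≠ 0}) hX hne : x ∈ (∅ : Set M))
  have hcompl : O B = (O A)ᶜ := by
    ext x
    simp only [O, mem_iUnion, mem_compl_iff, mem_ofPred_eq]
    constructor
    -- The indecomposable `W i x` lies in one of two complementary ideals of the fiber, so elements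
    -- of `A` and of `B` cannot both be nonzero at `x`.
    · rintro ⟨Y, hY, hYx⟩ ⟨X, hX, hXx⟩
      rcases hWx x with hle | hle
      · exact hYx (eq_zero_of_mem_isCompl (hfib x) (hle (Y.2 x))
          ⟨Y, LieSubmodule.mem_sup_left ⟨Y, hY, rfl⟩, rfl⟩)
      · exact hXx (eq_zero_of_mem_isCompl (hfib x) ⟨X, ⟨X, hX, rfl⟩, rfl⟩ (hle (X.2 x)))
    -- Conversely, a section of `W i` through a nonzero vector at `x` has an `A`-component vanishing
    -- at `x`, so its `B`-component does not vanish.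
    · intro hA0
      obtain ⟨v, hv, hv0⟩ := exists_mem_ne_zero ((hdecomp x).ne_bot i)
      obtain ⟨X, rfl⟩ := exists_apply_eq (𝕜 := 𝕜) (V := V) (𝔨 := 𝔨) (k := k) x v
      obtain ⟨Y, hY, -, hYX⟩ := hW.exists_section_projections hI i X
      obtain ⟨a, ha, b, hb, hab⟩ := exists_add_of_isCompl hAB ⟨Y i, hY i⟩
      refine ⟨b, hb, fun hb0 => hv0 ?_⟩
      have ha0 : a.1.1 x = 0 := by
        by_contra hne
        exact hA0 ⟨a, ha, hne⟩
      have h1 : a.1.1 x + b.1.1 x = (Y i).1 x :=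
        congrFun (congrArg (fun Z : sectionsIn 𝕜 V 𝔨 k (W i) => Z.1.1) hab) x
      rw [← hYX x hv, ← h1, ha0, hb0, add_zero]
  have hclopen : IsClopen (O A) := ⟨isOpen_compl_iff.mp (hcompl ▸ hOopen B), hOopen A⟩
  rcases isClopen_iff.mp hclopen with h0 | h0
  · have := hAB.sup_eq_top
    rw [hObot A h0, bot_sup_eq] at this
    exact hB this
  · have := hAB.sup_eq_top
    rw [hObot B (by rw [hcompl, h0, compl_univ]), sup_bot_eq] at this
    exact hA this

theorem IsAdapted.isIndecDecomp_sectionsIn [Fintype ι] {I : ι → LieIdeal 𝕜 𝔨}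
    {W : ι → ∀ x, LieIdeal 𝕜 (L x)} (hk : IsPerfect 𝕜 𝔨 ∨ IsCenterfree 𝕜 𝔨)
    (hW : IsAdapted I W) (hI : IsIndecDecomp 𝕜 I) :
    IsIndecDecomp 𝕜 fun i => sectionsIn 𝕜 V 𝔨 k (W i) := by
  have hind : iSupIndep fun i => sectionsIn 𝕜 V 𝔨 k (W i) :=
    iSupIndep_sectionsIn fun x => (hW.isIndecDecomp hI x).independent
  have htop : ⨆ i, sectionsIn 𝕜 V 𝔨 k (W i) = ⊤ := by
    by_cases hι : Nonempty ι
    · rw [eq_top_iff]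
      rintro X -
      obtain ⟨Y, hY, hYX, -⟩ := hW.exists_section_projections hI (Classical.arbitrary ι) X
      rw [← hYX]
      exact sum_mem fun i _ => LieSubmodule.mem_iSup_of_mem i (hY i)
    -- An empty decomposition forces all fibers, hence all sections, to be zero.
    · have : IsEmpty ι := not_nonempty_iff.mp hι
      rw [iSup_of_empty, eq_comm, LieSubmodule.eq_bot_iff]
      intro X _
      refine Subtype.ext (funext fun x => ?_)
      have hx := (hW.isIndecDecomp hI x).iSup_eq_top
      rw [iSup_of_empty] at hx
      exact (LieSubmodule.mem_bot _).mp (hx ▸ LieSubmodule.mem_top (X.1 x))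
  refine ⟨hind, htop, fun i => ?_, fun i =>
    hW.isIndecomposable_sectionsIn hk hI (isCompl_of_iSupIndep hind htop i)⟩
  obtain ⟨x⟩ : Nonempty M := inferInstance
  obtain ⟨v, hv, hv0⟩ := exists_mem_ne_zero ((hW.isIndecDecomp hI x).ne_bot i)
  obtain ⟨X, rfl⟩ := exists_apply_eq (𝕜 := 𝕜) (V := V) (𝔨 := 𝔨) (k := k) x v
  obtain ⟨Y, hY, -, hYX⟩ := hW.exists_section_projections hI i X
  refine fun hbot => hv0 ?_
  have h0 : Y i = 0 := (LieSubmodule.eq_bot_iff _).mp hbot _ (hY i)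
  rw [← hYX x hv, h0]
  rfl

end Decomposition

end LieSec

theorem mainTheorem7 {𝕜 : Type*} [RCLike 𝕜]
    {V : Type*} [NormedAddCommGroup V] [NormedSpace ℝ V] [FiniteDimensional ℝ V]
    {M : Type*} [TopologicalSpace M] [ChartedSpace V M] [IsManifold 𝓘(ℝ, V) ∞ M]
    [T2Space M] [ParacompactSpace M] [ConnectedSpace M]
    {𝔨 : Type*} [LieSec.NormedLieRing 𝔨] [LieSec.NormedLieAlgebra 𝕜 𝔨] [FiniteDimensional 𝕜 𝔨]
    [NormedSpace ℝ 𝔨] [IsScalarTower ℝ 𝕜 𝔨]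
    {L : M → Type*} [∀ x, LieRing (L x)] [∀ x, LieAlgebra 𝕜 (L x)]
    [∀ x, Module ℝ (L x)] [∀ x, IsScalarTower ℝ 𝕜 (L x)]
    [TopologicalSpace (TotalSpace 𝔨 L)] [∀ x, TopologicalSpace (L x)]
    [FiberBundle 𝔨 L] [VectorBundle ℝ 𝔨 L] [ContMDiffVectorBundle ∞ 𝔨 L 𝓘(ℝ, V)]
    [LieSec.LieAlgebraBundle 𝕜 𝔨 L]
    (k : ℕ∞)
    (hk : LieSec.IsPerfect 𝕜 𝔨 ∨ LieSec.IsCenterfree 𝕜 𝔨)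
    {n : ℕ} (I : Fin n → LieIdeal 𝕜 𝔨) (hI : LieSec.IsIndecDecomp 𝕜 I) :
    (SimplyConnectedSpace M → Subsingleton (LieSec.CechH1 M (LieSec.QuotGroup I hk hI))) ∧
    (Subsingleton (LieSec.CechH1 M (LieSec.QuotGroup I hk hI)) →
      ∃ W : Fin n → ∀ x, LieIdeal 𝕜 (L x),
        (∀ i, LieSec.IsSubbundle 𝕜 V (W i) (I i)) ∧
        LieSec.IsIndecDecomp 𝕜 (fun i => LieSec.sectionsIn 𝕜 V 𝔨 k (W i)) ∧
        ∀ (κ : Type*) (J : κ → LieIdeal 𝕜 (LieSec.sections 𝕜 V 𝔨 L k)),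
          LieSec.IsIndecDecomp 𝕜 J →
            ∃ σ : κ ≃ Fin n, ∀ j, J j = LieSec.sectionsIn 𝕜 V 𝔨 k (W (σ j))) := by
  -- Local path connectedness serves the lifting argument for coverings; σ-compactness serves finite
  -- generation and the partitions of unity.
  have : LocallyPathConnectedSpace M := ChartedSpace.locallyPathConnectedSpace V M
  have : LocallyCompactSpace M := ChartedSpace.locallyCompactSpace V M
  have : SigmaCompactSpace M := LieSec.sigmaCompactSpace_of_connected M
  refine ⟨fun _ => LieSec.subsingleton_cechH1, fun _ => ?_⟩
  obtain ⟨W, hW⟩ := LieSec.exists_isAdapted (L := L) hk hI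
  have hdecomp := hW.isIndecDecomp_sectionsIn (V := V) (k := k) hk hI
  exact ⟨W, hW.isSubbundle, hdecomp, fun κ J hJ =>
    hdecomp.exists_equiv (LieSec.isPerfect_or_isCenterfree_sections hk) hJ⟩
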